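/- Let $\mathbb S^1$ carry the normalized measure $d\theta/2\pi$, with $z=e^{i\theta}$, let $\hat f(k)$ be the Fourier coefficients of $f$, $\|f\|_{H^s}^2=\sum_{k\in\mathbb Z}(1+k^2)^s|\hat f(k)|^2$, let $\Pi\big(\sum_{k\in\mathbb Z}\hat f(k)e^{ik\theta}\big)=\sum_{k\ge0}\hat f(k)e^{ik\theta}$ be the Szegő projector, and let $H^{1/2}_+$ be the space of $f\in H^{1/2}(\mathbb S^1)$ with $\hat f(k)=0$ for all $k<0$. Write $(f|1)=\int_{\mathbb S^1} f\,\frac{d\theta}{2\pi}$ and $$Q(f)=\int_{\mathbb S^1}|f|^2\frac{d\theta}{2\pi},\qquad M(f)=\sum_{k\in\mathbb Z}k|\hat f(k)|^2,\qquad E_\alpha(f)=\frac14\int_{\mathbb S^1}|f|^4\frac{d\theta}{2\pi}+\frac{\alpha}{2}|(f|1)|^2 .$$ **Theorem.** Let $\alpha\in\mathbb R$ and let $u_0(z)=b_0+\dfrac{c_0z}{1-p_0z}$ with $b_0,c_0,p_0\in\mathbb C$, $c_0\neq0$, $|p_0|<1$. The $\alpha$-Szegő equation $$i\partial_tu=\Pi(|u|^2u)+\alpha\,(u|1),\qquad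 u(0)=u_0,$$ has a unique global solution $u\in C(\mathbb R;H^{1/2}_+)$ (in the sense of distributions), and the following holds. 1. If $\alpha<0$, then for every $s\ge0$ there is a constant $C$, independent of $t$, such that $u(t)\in H^s$ and $\|u(t)\|_{H^s}\le C$ for all $t\in\mathbb R$. 2. If $\alpha>0$, then for every $s>\frac12$ one has $u(t)\in H^s$ for all $t$, and there is a constant $C>0$ with $$\|u(t)\|_{H^s}\simeq e^{C|t|}\qquad(|t|\to\infty)$$ if and only if $$E_\alpha(u_0)=\frac14Q(u_0)^2+\frac{\alpha}{2}Q(u_0).$$ In that case the exponent $C>0$ depends only on $\alpha$, $s$, $Q(u_0)$ and $M(u_0)$. Here $f(t)\simeq g(t)$ as $|t|\to\infty$ means that there are constants $A,T>0$ (which may depend on $u$ and $s$) with $A^{-1}g(t)\le f(t)\le A\,g(t)$ for $|t|\ge T$. -/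

import Mathlib

open MeasureTheory Filter Topology Asymptotics AddCircle

namespace AlphaSzego

noncomputable section

/-- The circle, with angular coordinate `θ` modulo `2π`; the point `z = e^{iθ}` is `fourier 1 θ`.
All integrals are taken with respect to `haarAddCircle`, the normalized measure `dθ / 2π`. -/
abbrev Torus : Type := AddCircle (2 * Real.pi)

instance instFactTwoPiPos : Fact (0 < 2 * Real.pi) := ⟨Real.two_pi_pos⟩

/-- The Hilbert space `L²` of the circle, for the measure `dθ / 2π`. -/
abbrev L2 : Type := Lp ℂ 2 (haarAddCircle : Measure Torus)

/-- The average `(f | 1)` of `f` on the circle. -/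
def mean (f : Torus → ℂ) : ℂ := ∫ x, f x ∂haarAddCircle

/-- The mass `Q(f) = ∫ |f|² dθ/2π`. -/
def mass (f : Torus → ℂ) : ℝ := ∫ x, ‖f x‖ ^ 2 ∂haarAddCircle

/-- The momentum `M(f) = (D f | f)`, `D = -i ∂_θ`, written with Fourier coefficients. -/
def momentum (f : Torus → ℂ) : ℝ := ∑' k : ℤ, (k : ℝ) * ‖fourierCoeff f k‖ ^ 2

/-- The energy `E_α(f) = 1/4 ∫ |f|⁴ dθ/2π + α/2 |(f | 1)|²`. -/
def energy (α : ℝ) (f : Torus → ℂ) : ℝ :=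
  (1 / 4) * ∫ x, ‖f x‖ ^ 4 ∂haarAddCircle + (α / 2) * ‖mean f‖ ^ 2

/-- `f` belongs to the Sobolev space `H^s` of the circle. -/
def MemHs (s : ℝ) (f : L2) : Prop :=
  Summable fun k : ℤ => (1 + (k : ℝ) ^ 2) ^ s * ‖fourierCoeff f k‖ ^ 2

/-- The Sobolev norm `‖f‖_{H^s}`, for `f` in `H^s`. -/
def hsNorm (s : ℝ) (f : L2) : ℝ :=
  Real.sqrt (∑' k : ℤ, (1 + (k : ℝ) ^ 2) ^ s * ‖fourierCoeff f k‖ ^ 2)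

/-- `f` belongs to `L²₊`: its Fourier coefficients of negative index vanish. -/
def IsHardy (f : L2) : Prop := ∀ k : ℤ, k < 0 → fourierCoeff f k = 0

/-- The `k`-th Fourier coefficient of `Π f`, where `Π` is the Szegő projector
`Π (∑_{k ∈ ℤ} f̂(k) e^{ikθ}) = ∑_{k ≥ 0} f̂(k) e^{ikθ}`. -/
def szegoCoeff (f : Torus → ℂ) (k : ℤ) : ℂ := if 0 ≤ k then fourierCoeff f k else 0

/-- `u ∈ C(ℝ; H^{1/2}₊)` is a global solution of
`i ∂_t u = Π(|u|² u) + α (u | 1)`, `u(0) = u₀`.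
The equation is understood in the sense of distributions on the circle, that is, after pairing with
each `e^{ikθ}`. The cubic term is integrable, because `H^{1/2}` embeds in every `L^q`, `q < ∞`. -/
structure IsSolution (α : ℝ) (u₀ : Torus → ℂ) (u : ℝ → L2) : Prop where
  memHs : ∀ t, MemHs (1 / 2) (u t)
  hardy : ∀ t, IsHardy (u t)
  continuous : ∀ t, Tendsto (fun τ => hsNorm (1 / 2) (u τ - u t)) (𝓝 t) (𝓝 0)
  initial : u 0 =ᵐ[haarAddCircle] u₀
  equation : ∀ (k : ℤ) (t : ℝ),
    HasDerivAt (fun τ => fourierCoeff (u τ) k)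
      (-Complex.I * (szegoCoeff (fun x => (‖u t x‖ : ℂ) ^ 2 * u t x) k
        + α * fourierCoeff (fun _ : Torus => mean (u t)) k)) t

/-- The function `b + c z / (1 - p z)` on the circle. -/
def rationalData (b c p : ℂ) (x : Torus) : ℂ :=
  b + c * fourier 1 x / (1 - p * fourier 1 x)

/-- `‖u(t)‖_{H^s} ≃ e^{C|t|}` as `|t| → ∞`: each side is bounded by a constant multiple of the
other one when `|t|` is large. -/
def GrowsLikeExp (s C : ℝ) (u : ℝ → L2) : Prop :=
  (fun t => hsNorm s (u t)) =Θ[cocompact ℝ] (fun t => Real.exp (C * |t|))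

end

end AlphaSzego

open AlphaSzego

open scoped ComplexConjugate NNReal

/-! The functions `b + c z / (1 - p z)` with `|p| < 1` form an invariant family. With `f = z / (1 -
p z)`, the cubic term `|u|² u` is a combination of `1`, `f`, `f²` and `conj f`
(`rationalData_cubic`). The Szegő projector removes `conj f`, and what remains is tangent to the
family. Writing `c = (1 - |p|²) m` turns the equation into the ODE `field` for `(b, m, p)`.

Put `δ = 1 - |p|²`. The ODE conserves `M = |m|²`, `Q = |b|² + M δ` and `δ (|b + m conj p|² - α)`. By
`energy_rationalData`, the last quantity is, up to the factor `M / 2`, the energy minus `Q² / 4 + α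
Q / 2`. These laws, together with a linear equation for `δ`, keep the orbit bounded with `|p| < 1`,
so it is global.

Summing the weighted geometric series gives `‖u‖²_{H^s} ≈ δ^{-(2s-1)}` up to a bounded term
(`exists_hsNorm_sol_bounds`), so growth is governed by `δ`. If the third invariant is nonzero, as it
must be for `α < 0`, its second factor is bounded and so `δ` stays away from `0`
(`exists_delta_lower_bound`). If it vanishes, `y = 1 / δ` solves `y'' = κ² y - 2 M α` with `κ² =
rateSq α Q M > 0`, and both exponentials occur with positive coefficients (`delta_exponential`).
Hence `‖u‖_{H^s}` grows exactly like `e^{(s - 1/2) κ |t|}`.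

Uniqueness in `C(ℝ; H^{1/2}₊)` compares an arbitrary solution with the explicit one, which is
locally bounded in `L^∞`. In the `L²` estimate for the difference `w`, the worst term is real and
drops out. The remaining `|w|³` is controlled by `‖w‖_{L⁴}⁴ ≤ 4 ‖w‖_{L²}² ‖w‖_{H^{1/2}}²`
(`integral_four_le`), and Grönwall concludes (`IsSolution.eq_of_bounded`). -/

namespace AlphaSzego

/-! ### Ordinary differential equations. -/

/-- A bounded Lipschitz vector field on a Banach space is complete. -/
theorem exists_global_integral_curve {E : Type*} [NormedAddCommGroup E] [NormedSpace ℝ E]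
    [CompleteSpace E] {v : E → E} {K : ℝ≥0} (hv : LipschitzWith K v) {L : ℝ}
    (hL : ∀ x, ‖v x‖ ≤ L) (x₀ : E) :
    ∃ γ : ℝ → E, γ 0 = x₀ ∧ ∀ t, HasDerivAt γ (v (γ t)) t := by
  have hL0 : 0 ≤ L := (norm_nonneg _).trans (hL x₀)
  have key : ∀ T : ℝ, ∃ γ : ℝ → E, 0 < T → γ 0 = x₀ ∧
      ∀ t ∈ Set.Ioo (-T) T, HasDerivAt γ (v (γ t)) t := by
    intro T
    by_cases hT : 0 < T
    · have hP : IsPicardLindelof (fun _ ↦ v) (tmin := -T) (tmax := T)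
          ⟨0, by constructor <;> linarith⟩ x₀ (L.toNNReal * T.toNNReal) 0 L.toNNReal K := by
        refine IsPicardLindelof.of_time_independent (fun x _ ↦ ?_) hv.lipschitzOnWith ?_
        · simpa [Real.coe_toNNReal _ hL0] using hL x
        · simp [Real.coe_toNNReal _ hL0, Real.coe_toNNReal _ hT.le]
      obtain ⟨γ, h0, h1⟩ := hP.exists_eq_forall_mem_Icc_hasDerivWithinAt₀
      exact ⟨γ, fun _ ↦ ⟨h0, fun t ht ↦
        (h1 t (Set.Ioo_subset_Icc_self ht)).hasDerivAt (Icc_mem_nhds ht.1 ht.2)⟩⟩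
    · exact ⟨fun _ ↦ 0, fun h ↦ absurd h hT⟩
  choose γ hγ using key
  have heq : ∀ T T' : ℝ, 0 < T → T ≤ T' → Set.EqOn (γ T) (γ T') (Set.Ioo (-T) T) := by
    intro T T' hT hTT'
    refine ODE_solution_unique_of_mem_Ioo (v := fun _ ↦ v) (s := fun _ ↦ Set.univ) (K := K)
      (t₀ := 0) (fun _ _ ↦ hv.lipschitzOnWith) ⟨by linarith, hT⟩
      (fun t ht ↦ ⟨(hγ T hT).2 t ht, trivial⟩)
      (fun t ht ↦ ⟨(hγ T' (by linarith)).2 t ⟨by linarith [ht.1], by linarith [ht.2]⟩, trivial⟩) ?_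
    rw [(hγ T hT).1, (hγ T' (by linarith)).1]
  -- The value at `t` is read off the curve on `(-(|t| + 1), |t| + 1)`. For `τ` near `t` one has
  -- `|τ| + 1 ≤ |t| + 2`, so all these curves agree there with the single curve of half-length `|t|
  -- + 2`.
  refine ⟨fun t ↦ γ (|t| + 1) t, (hγ _ (by positivity)).1, fun t ↦ ?_⟩
  have hd := (hγ (|t| + 2) (by positivity)).2 t
    ⟨by linarith [neg_abs_le t], by linarith [le_abs_self t]⟩
  have hev : (fun τ ↦ γ (|τ| + 1) τ) =ᶠ[𝓝 t] γ (|t| + 2) := by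
    have : ∀ᶠ τ in 𝓝 t, |τ| < |t| + 1 :=
      (continuous_abs.tendsto t).eventually (gt_mem_nhds (by linarith))
    filter_upwards [this] with τ hτ
    exact heq _ _ (by positivity) (by linarith)
      ⟨by linarith [neg_abs_le τ], by linarith [le_abs_self τ]⟩
  have := hd.congr_of_eventuallyEq hev
  rwa [← hev.eq_of_nhds] at this

/-! ### The reduced system and its conservation laws. -/

/-- The vector field of the reduced system for `(b, m, p)`, where the solution is
`b + (1 - |p|²) m z / (1 - p z)`. -/
noncomputable def field (α : ℝ) (x : ℂ × ℂ × ℂ) : ℂ × ℂ × ℂ :=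
  (-Complex.I * (x.1 * conj x.1 * x.1
      + x.2.1 * conj x.2.1 * (1 - x.2.2 * conj x.2.2) * (2 * x.1 + x.2.1 * conj x.2.2)
      + α * x.1),
    -Complex.I * (x.2.1 * (2 * (x.1 * conj x.1) + x.2.1 * conj x.2.1
      + (conj x.1 * x.2.1 * conj x.2.2 + x.1 * conj x.2.1 * x.2.2))),
    -Complex.I * ((1 - x.2.2 * conj x.2.2) * (conj x.1 * x.2.1 + x.2.1 * conj x.2.1 * x.2.2)))

theorem contDiff_field (α : ℝ) : ContDiff ℝ 1 (field α) := by
  have hc : ContDiff ℝ 1 (fun z : ℂ ↦ conj z) := Complex.conjCLE.contDiff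
  have h1 : ContDiff ℝ 1 (fun x : ℂ × ℂ × ℂ ↦ conj x.1) := hc.comp contDiff_fst
  have h2 : ContDiff ℝ 1 (fun x : ℂ × ℂ × ℂ ↦ conj x.2.1) :=
    hc.comp (contDiff_fst.comp contDiff_snd)
  have h3 : ContDiff ℝ 1 (fun x : ℂ × ℂ × ℂ ↦ conj x.2.2) :=
    hc.comp (contDiff_snd.comp contDiff_snd)
  unfold field
  fun_prop

theorem hasDerivAt_conj {z : ℝ → ℂ} {z' : ℂ} {t : ℝ} (h : HasDerivAt z z' t) :
    HasDerivAt (fun τ ↦ conj (z τ)) (conj z') t := h.star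

theorem hasDerivAt_of_ofReal {f : ℝ → ℝ} {f' : ℂ} {t : ℝ}
    (h : HasDerivAt (fun τ ↦ (f τ : ℂ)) f' t) : HasDerivAt f f'.re t := by
  simpa using! (Complex.reCLM.hasFDerivAt.comp_hasDerivAt t h)

theorem eq_of_hasDerivAt_zero {E : Type*} [NormedAddCommGroup E] [NormedSpace ℝ E] {f : ℝ → E}
    (h : ∀ t, HasDerivAt f 0 t) (t : ℝ) : f t = f 0 :=
  is_const_of_deriv_eq_zero (fun t ↦ (h t).differentiableAt) (fun t ↦ (h t).deriv) t 0

/-- A solution of a scalar linear equation keeps its sign. -/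
theorem pos_of_linear_ode {f h : ℝ → ℝ} (hh : Continuous h)
    (hf : ∀ t, HasDerivAt f (h t * f t) t) (h0 : 0 < f 0) (t : ℝ) : 0 < f t := by
  have hH : ∀ t, HasDerivAt (fun t ↦ ∫ τ in (0 : ℝ)..t, h τ) (h t) t := fun t ↦
    (hh.integral_hasStrictDerivAt 0 t).hasDerivAt
  have := eq_of_hasDerivAt_zero (f := fun t ↦ f t * Real.exp (-∫ τ in (0 : ℝ)..t, h τ))
    (fun t ↦ by convert! (hf t).mul (hH t).neg.exp using 1; ring) t
  simp only [intervalIntegral.integral_same, neg_zero, Real.exp_zero, mul_one] at this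
  exact pos_of_mul_pos_left (this ▸ h0) (Real.exp_pos _).le

/-- `(b, m, p)` follows the reduced system, with time run at speed `g`. -/
structure IsOrbit (α : ℝ) (g : ℝ → ℝ) (b m p : ℝ → ℂ) : Prop where
  hb : ∀ t, HasDerivAt b (g t * (field α (b t, m t, p t)).1) t
  hm : ∀ t, HasDerivAt m (g t * (field α (b t, m t, p t)).2.1) t
  hp : ∀ t, HasDerivAt p (g t * (field α (b t, m t, p t)).2.2) t

theorem ofReal_norm_sq (z : ℂ) : ((‖z‖ ^ 2 : ℝ) : ℂ) = z * conj z := by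
  rw [Complex.mul_conj, Complex.normSq_eq_norm_sq]

namespace IsOrbit

variable {α : ℝ} {g : ℝ → ℝ} {b m p : ℝ → ℂ}

theorem continuous_b (h : IsOrbit α g b m p) : Continuous b :=
  continuous_iff_continuousAt.2 fun t ↦ (h.hb t).continuousAt

theorem continuous_m (h : IsOrbit α g b m p) : Continuous m :=
  continuous_iff_continuousAt.2 fun t ↦ (h.hm t).continuousAt

theorem continuous_p (h : IsOrbit α g b m p) : Continuous p :=
  continuous_iff_continuousAt.2 fun t ↦ (h.hp t).continuousAt

/-- The equation for `m` multiplies it by a purely imaginary factor. As `|m|²` is the momentum of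
the associated function, this is conservation of momentum. -/
theorem norm_m_eq (h : IsOrbit α g b m p) (t : ℝ) : ‖m t‖ = ‖m 0‖ := by
  have := eq_of_hasDerivAt_zero (f := fun t ↦ m t * conj (m t)) (fun t ↦ by
    convert! (h.hm t).mul (hasDerivAt_conj (h.hm t)) using 1
    simp only [field, map_mul, map_add, map_neg, map_ofNat, Complex.conj_I,
        Complex.conj_conj, Complex.conj_ofReal]
    ring) t
  simp only [← ofReal_norm_sq] at this
  exact (pow_left_inj₀ (norm_nonneg _) (norm_nonneg _) two_ne_zero).1 (by exact_mod_cast this)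

/-- This is conservation of `Q` written in the variables `(b, m, p)`. It bounds `b` as long as `|p|
≤ 1`. -/
theorem mass_eq (h : IsOrbit α g b m p) (t : ℝ) :
    ‖b t‖ ^ 2 + ‖m t‖ ^ 2 * (1 - ‖p t‖ ^ 2) = ‖b 0‖ ^ 2 + ‖m 0‖ ^ 2 * (1 - ‖p 0‖ ^ 2) := by
  have := eq_of_hasDerivAt_zero
    (f := fun t ↦ b t * conj (b t) + m t * conj (m t) * (1 - p t * conj (p t))) (fun t ↦ by
    convert! ((h.hb t).mul (hasDerivAt_conj (h.hb t))).add
      (((h.hm t).mul (hasDerivAt_conj (h.hm t))).mul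
        (((h.hp t).mul (hasDerivAt_conj (h.hp t))).const_sub 1)) using 1
    simp only [field, map_mul, map_add, map_sub, map_neg, map_one, map_ofNat, Complex.conj_I,
        Complex.conj_conj, Complex.conj_ofReal, Pi.mul_apply]
    ring) t
  simp only [← ofReal_norm_sq] at this
  exact_mod_cast this

/-- The equation for `p` carries the factor `1 - |p|²`, so `1 - |p|²` solves a scalar linear
equation and cannot reach zero. The unit disc is therefore invariant. -/
theorem hasDerivAt_delta (h : IsOrbit α g b m p) (t : ℝ) :
    HasDerivAt (fun t ↦ 1 - ‖p t‖ ^ 2)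
      (g t * (-2 * (conj (b t) * m t * conj (p t)).im) * (1 - ‖p t‖ ^ 2)) t := by
  have h2 : (fun τ ↦ ((1 - ‖p τ‖ ^ 2 : ℝ) : ℂ)) = fun τ ↦ 1 - p τ * conj (p τ) := by
    ext τ; rw [Complex.ofReal_sub, ofReal_norm_sq, Complex.ofReal_one]
  have h3 := hasDerivAt_of_ofReal (f := fun τ ↦ 1 - ‖p τ‖ ^ 2)
    (by rw [h2]; exact ((h.hp t).mul (hasDerivAt_conj (h.hp t))).const_sub 1)
  convert! h3 using 1
  have : ((g t * (-2 * (conj (b t) * m t * conj (p t)).im) * (1 - ‖p t‖ ^ 2) : ℝ) : ℂ)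
      = -(g t * (field α (b t, m t, p t)).2.2 * conj (p t)
        + p t * conj (g t * (field α (b t, m t, p t)).2.2)) := by
    have e1 : ((-2 * (conj (b t) * m t * conj (p t)).im : ℝ) : ℂ)
      = Complex.I * (conj (b t) * m t * conj (p t) - b t * conj (m t) * p t) := by
      apply Complex.ext <;> simp <;> ring
    rw [Complex.ofReal_mul, congrFun h2 t, Complex.ofReal_mul, e1]
    simp only [field, map_mul, map_add, map_sub, map_neg, map_one, Complex.conj_I,
      Complex.conj_conj, Complex.conj_ofReal]
    ring
  rw [← this, Complex.ofReal_re]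

theorem delta_pos (h : IsOrbit α g b m p) (hg : Continuous g) (h0 : ‖p 0‖ < 1) (t : ℝ) :
    0 < 1 - ‖p t‖ ^ 2 := by
  refine pos_of_linear_ode ?_ h.hasDerivAt_delta ?_ t
  · have := Complex.continuous_im
    have := Complex.continuous_conj
    have := h.continuous_b
    have := h.continuous_m
    have := h.continuous_p
    fun_prop
  · nlinarith [norm_nonneg (p 0)]

end IsOrbit

/-! ### Global orbits, and `1 - |p|²` away from the critical energy. -/

/-- `(b, m, p)` is a global solution of the reduced system, with `m ≠ 0` and `|p| < 1`. -/
structure IsReduced (α : ℝ) (b m p : ℝ → ℂ) : Prop where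
  orbit : IsOrbit α (fun _ ↦ 1) b m p
  m_ne : m 0 ≠ 0
  p_lt : ∀ t, ‖p t‖ < 1

/-- A cutoff makes the field bounded and Lipschitz, hence complete. Multiplying a field by a scalar
only changes the speed along its orbits, so the conservation laws survive the cutoff. They confine
the orbit to the region where the cutoff equals `1`, and the orbit thus solves the original system.
-/
theorem exists_isReduced (α : ℝ) {b₀ m₀ p₀ : ℂ} (hm₀ : m₀ ≠ 0) (hp₀ : ‖p₀‖ < 1) :
    ∃ b m p : ℝ → ℂ, IsReduced α b m p ∧ b 0 = b₀ ∧ m 0 = m₀ ∧ p 0 = p₀ := by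
  -- Chosen larger than the a priori bounds `|b|² ≤ |b₀|² + |m₀|²`, `|m| = |m₀|` and `|p| < 1`.
  set R : ℝ := 1 + ‖b₀‖ + 2 * ‖m₀‖ with hR
  have hR0 : 0 < R := by positivity
  let χ : ContDiffBump (0 : ℂ × ℂ × ℂ) := ⟨R, R + 1, hR0, by linarith⟩
  let v : ℂ × ℂ × ℂ → ℂ × ℂ × ℂ := fun x ↦ χ x • field α x
  have hv : ContDiff ℝ 1 v := χ.contDiff.smul (contDiff_field α)
  have hvs : HasCompactSupport v := χ.hasCompactSupport.smul_right
  obtain ⟨K, hK⟩ : ∃ K, LipschitzWith K v :=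
    hv.lipschitzWith_of_hasCompactSupport hvs one_ne_zero
  obtain ⟨L, hL⟩ := hvs.exists_bound_of_continuous hv.continuous
  obtain ⟨γ, hγ0, hγ⟩ := exists_global_integral_curve hK hL (b₀, m₀, p₀)
  let b : ℝ → ℂ := fun t ↦ (γ t).1
  let m : ℝ → ℂ := fun t ↦ (γ t).2.1
  let p : ℝ → ℂ := fun t ↦ (γ t).2.2
  let g : ℝ → ℝ := fun t ↦ χ (γ t)
  have h : IsOrbit α g b m p := by
    refine ⟨fun t ↦ ?_, fun t ↦ ?_, fun t ↦ ?_⟩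
    · simpa [v] using! (ContinuousLinearMap.fst ℝ ℂ (ℂ × ℂ)).hasFDerivAt.comp_hasDerivAt t (hγ t)
    · simpa [v] using! ((ContinuousLinearMap.fst ℝ ℂ ℂ).comp
        (ContinuousLinearMap.snd ℝ ℂ (ℂ × ℂ))).hasFDerivAt.comp_hasDerivAt t (hγ t)
    · simpa [v] using! ((ContinuousLinearMap.snd ℝ ℂ ℂ).comp
        (ContinuousLinearMap.snd ℝ ℂ (ℂ × ℂ))).hasFDerivAt.comp_hasDerivAt t (hγ t)
  have hgc : Continuous g :=
    χ.continuous.comp (continuous_iff_continuousAt.2 fun t ↦ (hγ t).continuousAt)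
  have hb0 : b 0 = b₀ := by simp [b, hγ0]
  have hm0 : m 0 = m₀ := by simp [m, hγ0]
  have hp0 : p 0 = p₀ := by simp [p, hγ0]
  have hp1 := h.delta_pos hgc (by rwa [hp0])
  have hg : g = fun _ ↦ 1 := by
    ext t
    refine χ.one_of_mem_closedBall ?_
    have h1 : ‖b t‖ ≤ R := by
      refine abs_le_of_sq_le_sq' (a := ‖b t‖) ?_ hR0.le |>.2
      have e1 := mul_nonneg (sq_nonneg ‖m t‖) (hp1 t).le
      have e2 := mul_nonneg (sq_nonneg ‖m₀‖) (sq_nonneg ‖p₀‖)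
      have e3 := h.mass_eq t
      rw [hb0, hm0, hp0] at e3
      nlinarith [norm_nonneg b₀, norm_nonneg m₀, mul_nonneg (norm_nonneg b₀) (norm_nonneg m₀)]
    have h2 : ‖m t‖ ≤ R := by
      rw [h.norm_m_eq t, hm0]
      linarith [norm_nonneg b₀, norm_nonneg m₀]
    have h3 : ‖p t‖ ≤ R := by nlinarith [hp1 t, norm_nonneg b₀, norm_nonneg m₀]
    simpa [Prod.norm_def] using ⟨h1, h2, h3⟩
  refine ⟨b, m, p, ⟨hg ▸ h, by rwa [hm0], fun t ↦ ?_⟩, hb0, hm0, hp0⟩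
  nlinarith [hp1 t, norm_nonneg (p t)]

namespace IsReduced

variable {α : ℝ} {b m p : ℝ → ℂ}

theorem hb (h : IsReduced α b m p) (t : ℝ) : HasDerivAt b (field α (b t, m t, p t)).1 t := by
  simpa using h.orbit.hb t

theorem hm (h : IsReduced α b m p) (t : ℝ) : HasDerivAt m (field α (b t, m t, p t)).2.1 t := by
  simpa using h.orbit.hm t

theorem hp (h : IsReduced α b m p) (t : ℝ) : HasDerivAt p (field α (b t, m t, p t)).2.2 t := by
  simpa using h.orbit.hp t

theorem delta_pos (h : IsReduced α b m p) (t : ℝ) : 0 < 1 - ‖p t‖ ^ 2 :=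
  h.orbit.delta_pos continuous_const (h.p_lt 0) t

theorem hasDerivAt_delta (h : IsReduced α b m p) (t : ℝ) :
    HasDerivAt (fun t ↦ 1 - ‖p t‖ ^ 2)
      (-(2 * (conj (b t) * m t * conj (p t)).im) * (1 - ‖p t‖ ^ 2)) t := by
  simpa using h.orbit.hasDerivAt_delta t

/-- The conservation law coming from the energy. -/
theorem delta_mul_eq (h : IsReduced α b m p) (t : ℝ) :
    (1 - ‖p t‖ ^ 2) * (‖b t + m t * conj (p t)‖ ^ 2 - α)
      = (1 - ‖p 0‖ ^ 2) * (‖b 0 + m 0 * conj (p 0)‖ ^ 2 - α) := by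
  have := eq_of_hasDerivAt_zero
    (f := fun t ↦ (1 - p t * conj (p t)) *
      ((b t + m t * conj (p t)) * conj (b t + m t * conj (p t)) - α)) (fun t ↦ by
    have hs := (h.hb t).add ((h.hm t).mul (hasDerivAt_conj (h.hp t)))
    convert! (((h.hp t).mul (hasDerivAt_conj (h.hp t))).const_sub 1).mul
      ((hs.mul (hasDerivAt_conj hs)).sub_const (α : ℂ)) using 1
    simp only [field, map_mul, map_add, map_sub, map_neg, map_one, map_ofNat, Complex.conj_I,
        Complex.conj_conj, Complex.conj_ofReal, Pi.mul_apply, Pi.add_apply]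
    ring) t
  simp only [← ofReal_norm_sq] at this
  exact_mod_cast this

theorem norm_shift_sq (b m p : ℂ) : ‖b + m * conj p‖ ^ 2
    = ‖b‖ ^ 2 + ‖m‖ ^ 2 * ‖p‖ ^ 2 + 2 * (conj b * m * conj p).re := by
  have : conj b * m * conj p = conj b * (m * conj p) := mul_assoc _ _ _
  rw [this, Complex.sq_norm, Complex.normSq_add, ← Complex.sq_norm, ← Complex.sq_norm, norm_mul,
    mul_pow, RCLike.norm_conj]
  congr 2
  rw [← Complex.conj_re]
  simp

/-- Away from the critical energy, `1 - |p|²` is bounded below. -/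
theorem exists_delta_lower_bound (h : IsReduced α b m p)
    (hK : ‖b 0 + m 0 * conj (p 0)‖ ^ 2 ≠ α) : ∃ d > 0, ∀ t, d ≤ 1 - ‖p t‖ ^ 2 := by
  set K := (1 - ‖p 0‖ ^ 2) * (‖b 0 + m 0 * conj (p 0)‖ ^ 2 - α) with hKdef
  have hK0 : 0 < |K| := abs_pos.2 (mul_ne_zero (h.delta_pos 0).ne' (sub_ne_zero.2 hK))
  -- An upper bound for the second factor of the invariant: `(|b| + |m|)² ≤ 2 |b|² + 2 |m|²` with
  -- `|b|² ≤ |b 0|² + |m 0|²`. The final `1` makes it positive.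
  set B := 2 * (‖b 0‖ ^ 2 + 2 * ‖m 0‖ ^ 2) + |α| + 1
  have hB : 0 < B := by positivity
  refine ⟨|K| / B, by positivity, fun t ↦ ?_⟩
  rw [div_le_iff₀ hB, hKdef, ← h.delta_mul_eq t, abs_mul, abs_of_pos (h.delta_pos t)]
  refine mul_le_mul_of_nonneg_left ?_ (h.delta_pos t).le
  have h1 : ‖b t + m t * conj (p t)‖ ≤ ‖b t‖ + ‖m 0‖ := by
    refine (norm_add_le _ _).trans (add_le_add le_rfl ?_)
    rw [norm_mul, RCLike.norm_conj, h.orbit.norm_m_eq t]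
    exact mul_le_of_le_one_right (norm_nonneg _) (h.p_lt t).le
  have h2 := h.orbit.mass_eq t
  have h3 := mul_nonneg (sq_nonneg ‖m t‖) (h.delta_pos t).le
  have h4 := mul_nonneg (sq_nonneg ‖m 0‖) (sq_nonneg ‖p 0‖)
  have h5 : ‖b t + m t * conj (p t)‖ ^ 2 ≤ (‖b t‖ + ‖m 0‖) ^ 2 :=
    pow_le_pow_left₀ (norm_nonneg _) h1 2
  have h6 : |‖b t + m t * conj (p t)‖ ^ 2 - α| ≤ ‖b t + m t * conj (p t)‖ ^ 2 + |α| := by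
    refine (abs_sub _ _).trans ?_
    rw [abs_of_nonneg (sq_nonneg _)]
  nlinarith [sq_nonneg (‖b t‖ - ‖m 0‖)]

/-! ### Exponential decay of `1 - |p|²` at the critical energy. -/

/-- The square of the exponential rate. -/
noncomputable def rateSq (α Q M : ℝ) : ℝ := 4 * M * Q - (α - Q - M) ^ 2

/-- At the critical energy, `1 - |p|²` decays exponentially in both time directions. -/
theorem delta_exponential (h : IsReduced α b m p) (hα : 0 < α) {Q M : ℝ}
    (hQ : Q = ‖b 0‖ ^ 2 + ‖m 0‖ ^ 2 * (1 - ‖p 0‖ ^ 2)) (hM : M = ‖m 0‖ ^ 2)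
    (hK : ‖b 0 + m 0 * conj (p 0)‖ ^ 2 = α) :
    0 < rateSq α Q M ∧ ∃ A₁ > 0, ∃ A₂ > 0, ∀ t,
      A₁ * Real.exp (Real.sqrt (rateSq α Q M) * |t|) ≤ (1 - ‖p t‖ ^ 2)⁻¹ ∧
      (1 - ‖p t‖ ^ 2)⁻¹ ≤ A₂ * Real.exp (Real.sqrt (rateSq α Q M) * |t|) := by
  have hM0 : 0 < M := by rw [hM]; have := norm_pos_iff.2 h.m_ne; positivity
  set δ : ℝ → ℝ := fun t ↦ 1 - ‖p t‖ ^ 2 with hδ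
  have hδ0 : ∀ t, 0 < δ t := h.delta_pos
  set w : ℝ → ℂ := fun t ↦ conj (b t) * m t * conj (p t) with hw
  have hMt : ∀ t, ‖m t‖ ^ 2 = M := fun t ↦ by rw [hM, h.orbit.norm_m_eq t]
  have hQt : ∀ t, ‖b t‖ ^ 2 = Q - M * δ t := fun t ↦ by
    have := h.orbit.mass_eq t
    rw [← hQ, hMt t] at this
    linarith
  have hpt : ∀ t, ‖p t‖ ^ 2 = 1 - δ t := fun t ↦ by simp [hδ]
  have hKt : ∀ t, ‖b t + m t * conj (p t)‖ ^ 2 = α := fun t ↦ by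
    have := h.delta_mul_eq t
    rw [hK, sub_self, mul_zero] at this
    exact sub_eq_zero.1 ((mul_eq_zero.1 this).resolve_left (hδ0 t).ne')
  have hre : ∀ t, 2 * (w t).re = α - Q - M + 2 * M * δ t := fun t ↦ by
    have := hKt t
    rw [norm_shift_sq, hMt, hpt, hQt] at this
    simp only [hw]
    linarith
  -- Both `|w|²` and `Re w` are polynomials in `δ` by the conservation laws. The `δ²` terms cancel
  -- in `4 |w|² - (2 Re w)²`.
  have him : ∀ t, (2 * (w t).im) ^ 2 = rateSq α Q M - 4 * M * α * δ t := fun t ↦ by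
    have h1 : (w t).re ^ 2 + (w t).im ^ 2 = (Q - M * δ t) * M * (1 - δ t) := by
      rw [← hpt, ← hQt, ← hMt t, ← mul_pow, ← mul_pow, ← RCLike.norm_conj (b t),
        ← RCLike.norm_conj (p t), ← norm_mul, ← norm_mul, Complex.sq_norm, Complex.normSq_apply]
      ring
    have h2 := hre t
    rw [rateSq]
    have h3 : (2 * (w t).re) ^ 2 = (α - Q - M + 2 * M * δ t) ^ 2 := by rw [h2]
    nlinarith
  have hg : ∀ t, HasDerivAt (fun t ↦ 2 * (w t).im) (2 * M * α * δ t) t := fun t ↦ by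
    have h1 := ((hasDerivAt_conj (h.hb t)).mul (h.hm t)).mul (hasDerivAt_conj (h.hp t))
    have h2 := (Complex.imCLM.hasFDerivAt.comp_hasDerivAt t h1).const_mul 2
    convert! h2 using 1
    have hc : (b t + m t * conj (p t)) * conj (b t + m t * conj (p t)) = α := by
      rw [← ofReal_norm_sq, hKt]
    simp only [map_add, map_mul, Complex.conj_conj] at hc
    have hMc : (M : ℂ) = m t * conj (m t) := by rw [← ofReal_norm_sq, hMt]
    have hδc : (δ t : ℂ) = 1 - p t * conj (p t) := by
      rw [← ofReal_norm_sq, hpt]; push_cast; ring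
    have key : (conj (field α (b t, m t, p t)).1 * m t
          + conj (b t) * (field α (b t, m t, p t)).2.1) * conj (p t)
          + conj (b t) * m t * conj (field α (b t, m t, p t)).2.2
        = Complex.I * (M * δ t) * (2 * w t + ((‖b t‖ ^ 2 + M * ‖p t‖ ^ 2 : ℝ) : ℂ)) := by
      have e : ((‖b t‖ ^ 2 + M * ‖p t‖ ^ 2 : ℝ) : ℂ)
          = b t * conj (b t) + m t * conj (m t) * (p t * conj (p t)) := by
        rw [Complex.ofReal_add, Complex.ofReal_mul, ofReal_norm_sq, ofReal_norm_sq, hMc]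
      rw [e, hMc, hδc]
      simp only [field, map_mul, map_add, map_sub, map_neg, map_one, map_ofNat, Complex.conj_I,
        Complex.conj_conj, Complex.conj_ofReal, hw]
      -- Criticality replaces the `α` of the equation for `b` by `|b + m conj p|²`.
      linear_combination (-Complex.I * conj (b t) * m t * conj (p t)) * hc
    simp only [Pi.mul_apply, Complex.imCLM_apply]
    rw [key]
    have e2 : 2 * (w t).re = α - (‖b t‖ ^ 2 + M * ‖p t‖ ^ 2) := by rw [hre, hQt, hpt]; ring
    have e3 : (Complex.I * (M * δ t) * (2 * w t + ((‖b t‖ ^ 2 + M * ‖p t‖ ^ 2 : ℝ) : ℂ))).im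
        = M * δ t * (2 * (w t).re + (‖b t‖ ^ 2 + M * ‖p t‖ ^ 2)) := by
      rw [show Complex.I * (M * δ t) * (2 * w t + ((‖b t‖ ^ 2 + M * ‖p t‖ ^ 2 : ℝ) : ℂ))
        = ((M * δ t : ℝ) : ℂ) * (Complex.I * (2 * w t + ((‖b t‖ ^ 2 + M * ‖p t‖ ^ 2 : ℝ) : ℂ))) by
          push_cast; ring, Complex.im_ofReal_mul, Complex.I_mul_im, Complex.add_re,
        Complex.ofReal_re]
      simp
    rw [e3, e2]
    ring
  set g : ℝ → ℝ := fun t ↦ 2 * (w t).im with hgdef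
  have hκ2 : 0 < rateSq α Q M := by
    have := him 0
    have := mul_pos (mul_pos (mul_pos four_pos hM0) hα) (hδ0 0)
    nlinarith [sq_nonneg (2 * (w 0).im)]
  refine ⟨hκ2, ?_⟩
  set κ := Real.sqrt (rateSq α Q M) with hκdef
  have hκ : 0 < κ := Real.sqrt_pos.2 hκ2
  have hκsq : rateSq α Q M = κ ^ 2 := (Real.sq_sqrt hκ2.le).symm
  have hdδ : ∀ t, HasDerivAt δ (-g t * δ t) t := h.hasDerivAt_delta
  have hy : ∀ t, HasDerivAt (fun t ↦ (δ t)⁻¹) (g t * (δ t)⁻¹) t := fun t ↦ by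
    convert! (hdδ t).inv (hδ0 t).ne' using 1
    have := (hδ0 t).ne'
    field_simp
  -- Substituting the formula for `(2 Im w)²` makes the second-order equation for `1 / δ` linear
  -- with constant coefficients.
  have hy' : ∀ t, HasDerivAt (fun t ↦ g t * (δ t)⁻¹) (κ ^ 2 * (δ t)⁻¹ - 2 * M * α) t := fun t ↦ by
    convert! (hg t).mul (hy t) using 1
    have e := him t
    rw [hκsq] at e
    have := (hδ0 t).ne'
    have e' : g t * (g t * (δ t)⁻¹) = (κ ^ 2 - 4 * M * α * δ t) * (δ t)⁻¹ := by rw [← e]; ring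
    rw [e']
    field_simp
    ring
  -- The equilibrium of `y'' = κ² y - 2 M α`. The combinations `κ (y - e₀) ± y'` are then pure
  -- exponentials.
  set e₀ := 2 * M * α / κ ^ 2 with he₀
  have he₀' : κ ^ 2 * e₀ = 2 * M * α := by rw [he₀]; field_simp
  have he₀pos : 0 < e₀ := by positivity
  have hexp : ∀ σ : ℝ, σ ^ 2 = 1 → ∀ t,
      κ * ((δ t)⁻¹ - e₀) + σ * (g t * (δ t)⁻¹)
        = (κ * ((δ 0)⁻¹ - e₀) + σ * (g 0 * (δ 0)⁻¹)) * Real.exp (σ * κ * t) := by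
    intro σ hσ t
    have h1 := eq_of_hasDerivAt_zero
      (f := fun t ↦ (κ * ((δ t)⁻¹ - e₀) + σ * (g t * (δ t)⁻¹)) * Real.exp (-(σ * κ * t)))
      (fun t ↦ by
        convert! ((((hy t).sub_const e₀).const_mul κ).add ((hy' t).const_mul σ)).mul
          (((hasDerivAt_id t).const_mul (σ * κ)).neg.exp) using 1
        simp only [Pi.add_apply, id]
        linear_combination (Real.exp (-(σ * κ * t)) * (κ * g t * (δ t)⁻¹)) * hσ
          - σ * Real.exp (-(σ * κ * t)) * he₀') t
    simp only [mul_zero, neg_zero, Real.exp_zero, mul_one] at h1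
    rw [← h1, mul_assoc _ (Real.exp _), ← Real.exp_add, neg_add_cancel, Real.exp_zero, mul_one]
  set P := κ * ((δ 0)⁻¹ - e₀) + 1 * (g 0 * (δ 0)⁻¹) with hP
  set N := κ * ((δ 0)⁻¹ - e₀) + (-1) * (g 0 * (δ 0)⁻¹) with hN
  -- The first integral linking `y'` to `y` gives `P N = κ² e₀²`. So `P` and `N` have the same sign,
  -- and `P + N > 0` makes both positive. This yields growth in both time directions.
  have hPN : 0 < P * N := by
    have : P * N = κ ^ 2 * e₀ ^ 2 := by
      have e := him 0
      rw [hκsq] at e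
      have hd := mul_inv_cancel₀ (hδ0 0).ne'
      have e' : (g 0 * (δ 0)⁻¹) ^ 2 = κ ^ 2 * (δ 0)⁻¹ ^ 2 - 4 * M * α * (δ 0)⁻¹ := by
        rw [mul_pow, hgdef]
        simp only
        rw [e]
        linear_combination (-4 * M * α * (δ 0)⁻¹) * hd
      rw [hP, hN]
      linear_combination -e' - 2 * (δ 0)⁻¹ * he₀'
    rw [this]; positivity
  have hsum : 0 < P + N := by
    have : e₀ < (δ 0)⁻¹ := by
      have e := him 0
      rw [hκsq] at e
      have e1 : 2 * M * α * δ 0 < κ ^ 2 := by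
        have := mul_pos (mul_pos (mul_pos two_pos hM0) hα) (hδ0 0)
        nlinarith [sq_nonneg (2 * (w 0).im)]
      rw [he₀, ← one_div, div_lt_div_iff₀ (by positivity) (hδ0 0)]
      linarith
    have : P + N = 2 * κ * ((δ 0)⁻¹ - e₀) := by rw [hP, hN]; ring
    rw [this]
    exact mul_pos (by positivity) (by linarith)
  have hPpos : 0 < P := by
    by_contra! hP'
    have : 0 < N := by linarith
    nlinarith
  have hNpos : 0 < N := by
    by_contra! hN'
    nlinarith
  have hsol : ∀ t, (δ t)⁻¹ = e₀ + (P * Real.exp (κ * t) + N * Real.exp (-(κ * t))) / (2 * κ) := by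
    intro t
    have h1 := hexp 1 (by norm_num) t
    have h2 := hexp (-1) (by norm_num) t
    rw [← hP] at h1
    rw [← hN] at h2
    simp only [one_mul, neg_mul] at h1 h2
    rw [← h1, ← h2]
    field_simp
    ring
  clear_value P N e₀
  refine ⟨min P N / (2 * κ), by positivity, e₀ + (P + N) / (2 * κ), by positivity, fun t ↦ ?_⟩
  rw [hsol t]
  have hE : 1 ≤ Real.exp (κ * |t|) := Real.one_le_exp (by positivity)
  have hp1 : Real.exp (κ * t) ≤ Real.exp (κ * |t|) :=
    Real.exp_le_exp.2 (mul_le_mul_of_nonneg_left (le_abs_self t) hκ.le)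
  have hp2 : Real.exp (-(κ * t)) ≤ Real.exp (κ * |t|) := by
    rw [← mul_neg]
    exact Real.exp_le_exp.2 (mul_le_mul_of_nonneg_left (neg_le_abs t) hκ.le)
  constructor
  · have : min P N * Real.exp (κ * |t|) ≤ P * Real.exp (κ * t) + N * Real.exp (-(κ * t)) := by
      rcases abs_cases t with ⟨ht, _⟩ | ⟨ht, _⟩
      · rw [ht]
        have := mul_le_mul_of_nonneg_right (min_le_left P N) (Real.exp_pos (κ * t)).le
        have := mul_pos hNpos (Real.exp_pos (-(κ * t)))
        linarith
      · rw [ht, mul_neg]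
        have := mul_le_mul_of_nonneg_right (min_le_right P N) (Real.exp_pos (-(κ * t))).le
        have := mul_pos hPpos (Real.exp_pos (κ * t))
        linarith
    rw [div_mul_eq_mul_div]
    have := div_le_div_of_nonneg_right this (by positivity : 0 ≤ 2 * κ)
    linarith
  · rw [add_mul, div_mul_eq_mul_div]
    have h1 : e₀ ≤ e₀ * Real.exp (κ * |t|) := le_mul_of_one_le_right he₀pos.le hE
    have h2 : P * Real.exp (κ * t) + N * Real.exp (-(κ * t)) ≤ (P + N) * Real.exp (κ * |t|) := by
      rw [add_mul]
      gcongr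
    have := div_le_div_of_nonneg_right h2 (by positivity : 0 ≤ 2 * κ)
    linarith

end IsReduced

/-! ### Fourier coefficients -/

theorem norm_fourier_apply (n : ℤ) (x : Torus) : ‖fourier n x‖ = 1 := by
  rw [fourier_apply]; exact Circle.norm_coe _

theorem fourier_mul_conj (n : ℤ) (x : Torus) : fourier n x * conj (fourier n x) = 1 := by
  rw [Complex.mul_conj, Complex.normSq_eq_norm_sq, norm_fourier_apply]; simp

theorem fourier_natCast (n : ℕ) (x : Torus) : fourier (n : ℤ) x = fourier 1 x ^ n := by
  induction n with
  | zero => simp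
  | succ n ih => rw [Nat.cast_succ, fourier_add, ih, pow_succ]

theorem integrable_of_continuous {F : Torus → ℂ} (hF : Continuous F) :
    Integrable F haarAddCircle :=
  hF.integrable_of_hasCompactSupport (HasCompactSupport.of_compactSpace F)

theorem fourierCoeff_eq_integral (F : Torus → ℂ) (k : ℤ) :
    fourierCoeff F k = ∫ x, conj (fourier k x) * F x ∂haarAddCircle := by
  simp only [fourierCoeff, fourier_neg, smul_eq_mul]

theorem fourierCoeff_const (a : ℂ) (k : ℤ) :
    fourierCoeff (fun _ : Torus ↦ a) k = if k = 0 then a else 0 := by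
  have h := fourierCoeff.const_mul (T := 2 * Real.pi) (fun x ↦ fourier 0 x) a k
  have h' := congrFun (fourierCoeff_fourier (T := 2 * Real.pi) 0) k
  rw [h'] at h
  simp only [fourier_zero, mul_one] at h
  rw [h]
  by_cases hk : k = 0 <;> simp [hk]

theorem fourierCoeff_fourier_mul (F : Torus → ℂ) (j k : ℤ) :
    fourierCoeff (fun x ↦ fourier j x * F x) k = fourierCoeff F (k - j) := by
  simp only [fourierCoeff, smul_eq_mul, ← mul_assoc, ← fourier_add]
  congr! 5
  ring

theorem fourierCoeff_conj (F : Torus → ℂ) (k : ℤ) :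
    fourierCoeff (fun x ↦ conj (F x)) k = conj (fourierCoeff F (-k)) := by
  rw [fourierCoeff_eq_integral, fourierCoeff_eq_integral, ← integral_conj]
  simp [fourier_neg, -fourier_apply]

/-- The Fourier coefficients of the sum of an absolutely convergent power series. -/
theorem fourierCoeff_of_hasSum {F : Torus → ℂ} {a : ℕ → ℂ} (ha : Summable fun n ↦ ‖a n‖)
    (hF : ∀ x, HasSum (fun n ↦ a n * fourier 1 x ^ n) (F x)) (k : ℤ) :
    fourierCoeff F k = if 0 ≤ k then a k.toNat else 0 := by
  have h1 : ∀ n : ℕ, ∫ x : Torus, conj (fourier k x) * (a n * fourier 1 x ^ n) ∂haarAddCircle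
      = if k = n then a n else 0 := by
    intro n
    rw [← fourierCoeff_eq_integral, fourierCoeff.const_mul]
    simp only [← fourier_natCast]
    rw [show (fun x : Torus ↦ fourier (n : ℤ) x) = fourier (n : ℤ) from rfl, fourierCoeff_fourier]
    simp [Pi.single_apply]
  have h2 := hasSum_integral_of_summable_integral_norm (μ := (haarAddCircle : Measure Torus))
    (F := fun (n : ℕ) (x : Torus) ↦ conj (fourier k x) * (a n * fourier 1 x ^ n))
    (fun n ↦ integrable_of_continuous (by
      have := Complex.continuous_conj
      have := (fourier k : C(Torus, ℂ)).continuous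
      have := (fourier 1 : C(Torus, ℂ)).continuous
      fun_prop))
    (by simpa [norm_fourier_apply, -fourier_apply] using ha)
  have h3 : ∀ x : Torus, ∑' n : ℕ, conj (fourier k x) * (a n * fourier 1 x ^ n)
      = conj (fourier k x) * F x := fun x ↦ ((hF x).mul_left _).tsum_eq
  simp only [h1, h3, ← fourierCoeff_eq_integral] at h2
  split_ifs with hk
  · lift k to ℕ using hk
    refine h2.unique ?_
    have h4 := hasSum_single (f := fun n : ℕ ↦ if (k : ℤ) = n then a n else 0) k
      (fun n hn ↦ if_neg (by omega))
    simpa using h4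
  · refine h2.unique ?_
    convert! hasSum_zero using 2 with n
    rw [if_neg]
    omega

/-- Mode zero is split off because it carries `b`, while the geometric coefficients `c pⁿ` start at
index one. -/
theorem hasSum_int_of_nonneg {F : ℤ → ℝ} (hneg : ∀ k < 0, F k = 0) {S : ℝ}
    (h : HasSum (fun n : ℕ ↦ F (n + 1)) S) : HasSum F (F 0 + S) := by
  have h1 : HasSum (fun n : ℕ ↦ F n) (F 0 + S) := by
    rw [← hasSum_nat_add_iff' 1]
    simpa using h
  refine (Function.Injective.hasSum_iff Nat.cast_injective fun k hk ↦ ?_).1 h1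
  refine hneg k ?_
  by_contra! hk'
  exact hk ⟨k.toNat, by simpa using hk'⟩

/-! ### The function `z / (1 - p z)` -/

/-- The function `z / (1 - p z)` on the circle. -/
noncomputable def pole (p : ℂ) (x : Torus) : ℂ := fourier 1 x / (1 - p * fourier 1 x)

section pole

variable {p : ℂ}

theorem one_sub_mul_ne_zero (hp : ‖p‖ < 1) (x : Torus) : 1 - p * fourier 1 x ≠ 0 := by
  intro h
  have : ‖p * fourier 1 x‖ = 1 := by rw [← sub_eq_zero.1 h, norm_one]
  rw [norm_mul, norm_fourier_apply, mul_one] at this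
  exact hp.ne this

theorem continuous_pole (hp : ‖p‖ < 1) : Continuous (pole p) := by
  have := (fourier 1 : C(Torus, ℂ)).continuous
  exact this.div (by fun_prop) (one_sub_mul_ne_zero hp)

theorem rationalData_eq (b c p : ℂ) : rationalData b c p = fun x ↦ b + c * pole p x := by
  ext x; simp only [rationalData, pole, mul_div_assoc]

theorem continuous_rationalData (b c : ℂ) (hp : ‖p‖ < 1) : Continuous (rationalData b c p) := by
  rw [rationalData_eq]
  have := continuous_pole hp
  fun_prop

theorem fourierCoeff_pole (hp : ‖p‖ < 1) (k : ℤ) :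
    fourierCoeff (pole p) k = if 0 ≤ k - 1 then p ^ (k - 1).toNat else 0 := by
  have h1 : pole p = fun x ↦ fourier 1 x * (1 - p * fourier 1 x)⁻¹ := by
    ext x; rw [pole, div_eq_mul_inv]
  rw [h1, fourierCoeff_fourier_mul]
  refine fourierCoeff_of_hasSum (by simpa using hp) (fun x ↦ ?_) _
  simp only [← mul_pow]
  exact hasSum_geometric_of_norm_lt_one (by rwa [norm_mul, norm_fourier_apply, mul_one])

theorem fourierCoeff_pole_sq (hp : ‖p‖ < 1) (k : ℤ) :
    fourierCoeff (fun x ↦ pole p x ^ 2) k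
      = if 0 ≤ k - 2 then ((k - 2).toNat + 1) * p ^ (k - 2).toNat else 0 := by
  have h1 : (fun x ↦ pole p x ^ 2) = fun x ↦ fourier 2 x * (1 / (1 - p * fourier 1 x) ^ 2) := by
    ext x
    rw [pole, div_pow, div_eq_mul_one_div, show (2 : ℤ) = ((2 : ℕ) : ℤ) from rfl, fourier_natCast]
  rw [h1, fourierCoeff_fourier_mul]
  refine fourierCoeff_of_hasSum (a := fun n ↦ ((n : ℂ) + 1) * p ^ n) ?_ (fun x ↦ ?_) _
  · have := summable_norm_geometric_of_norm_lt_one hp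
    have h2 := (summable_norm_pow_mul_geometric_of_norm_lt_one 1 hp).add this
    refine h2.of_nonneg_of_le (fun _ ↦ norm_nonneg _) fun n ↦ ?_
    rw [add_mul, one_mul, pow_one]
    exact norm_add_le _ _
  · have := hasSum_choose_mul_geometric_of_norm_lt_one (𝕜 := ℂ) 1 (r := p * fourier 1 x)
      (by rwa [norm_mul, norm_fourier_apply, mul_one])
    simpa [mul_pow, mul_assoc] using this

theorem fourierCoeff_pole_of_nonpos (hp : ‖p‖ < 1) {k : ℤ} (hk : k ≤ 0) :
    fourierCoeff (pole p) k = 0 := by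
  rw [fourierCoeff_pole hp, if_neg (by omega)]

theorem fourierCoeff_pole_succ (hp : ‖p‖ < 1) (n : ℕ) :
    fourierCoeff (pole p) (n + 1) = p ^ n := by
  simp [fourierCoeff_pole hp]

theorem fourierCoeff_pole_sq_of_nonpos (hp : ‖p‖ < 1) {k : ℤ} (hk : k ≤ 0) :
    fourierCoeff (fun x ↦ pole p x ^ 2) k = 0 := by
  rw [fourierCoeff_pole_sq hp, if_neg (by omega)]

theorem fourierCoeff_pole_sq_succ (hp : ‖p‖ < 1) (n : ℕ) :
    fourierCoeff (fun x ↦ pole p x ^ 2) (n + 1) = n * p ^ (n - 1) := by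
  rw [fourierCoeff_pole_sq hp]
  rcases n with _ | n
  · simp
  · rw [if_pos (by push_cast; omega), show (((n + 1 : ℕ) : ℤ) + 1 - 2).toNat = n by omega]
    simp

theorem fourierCoeff_rationalData (b c : ℂ) (hp : ‖p‖ < 1) (k : ℤ) :
    fourierCoeff (rationalData b c p) k = (if k = 0 then b else 0) + c * fourierCoeff (pole p) k := by
  have h := continuous_pole hp
  rw [rationalData_eq]
  have := congrFun (fourierCoeff.add (integrable_of_continuous (continuous_const (y := b)))
    (integrable_of_continuous (by fun_prop : Continuous fun x ↦ c * pole p x))) k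
  simp only [Pi.add_apply] at this
  rw [← fourierCoeff_const, ← fourierCoeff.const_mul, ← this]
  rfl

theorem fourierCoeff_rationalData_neg (b c : ℂ) (hp : ‖p‖ < 1) {k : ℤ} (hk : k < 0) :
    fourierCoeff (rationalData b c p) k = 0 := by
  rw [fourierCoeff_rationalData b c hp, if_neg hk.ne, fourierCoeff_pole_of_nonpos hp hk.le]
  simp

theorem fourierCoeff_rationalData_zero (b c : ℂ) (hp : ‖p‖ < 1) :
    fourierCoeff (rationalData b c p) 0 = b := by
  simp [fourierCoeff_rationalData b c hp, fourierCoeff_pole_of_nonpos hp]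

theorem fourierCoeff_rationalData_succ (b c : ℂ) (hp : ‖p‖ < 1) (n : ℕ) :
    fourierCoeff (rationalData b c p) (n + 1) = c * p ^ n := by
  rw [fourierCoeff_rationalData b c hp, fourierCoeff_pole_succ hp, if_neg (by omega), zero_add]

theorem one_sub_mul_conj_ne_zero (hp : ‖p‖ < 1) : 1 - p * conj p ≠ 0 := by
  rw [← ofReal_norm_sq]
  have : (0 : ℝ) < 1 - ‖p‖ ^ 2 := by nlinarith [norm_nonneg p]
  exact_mod_cast this.ne'

/-- On the circle `conj z = 1 / z`, so `|f|² = 1 / |1 - p z|²` is a multiple of the Poisson kernel,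
and partial fractions make it affine in `f` and `conj f`. Repeated use reduces every mixed product
to pure powers. -/
theorem pole_mul_conj (hp : ‖p‖ < 1) (x : Torus) : pole p x * conj (pole p x)
    = (1 + p * pole p x + conj p * conj (pole p x)) / (1 - p * conj p) := by
  have hz := fourier_mul_conj 1 x
  have h1 := one_sub_mul_ne_zero hp x
  have h2 : 1 - conj p * conj (fourier 1 x) ≠ 0 := by
    simpa [-fourier_apply] using (map_ne_zero (starRingEnd ℂ)).2 h1
  have h3 := one_sub_mul_conj_ne_zero hp
  simp only [pole, map_mul, map_div₀, map_sub, map_one]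
  generalize fourier 1 x = z at *
  generalize conj z = y at *
  generalize conj p = q at *
  have h4 : 1 - z * p ≠ 0 := by rwa [mul_comm z p]
  have h5 : 1 - y * q ≠ 0 := by rwa [mul_comm y q]
  field_simp
  linear_combination hz

/-- The decomposition of `|u|² u`, for `u = b + c f` with `f = z / (1 - p z)`, into a polynomial in
`f` and a multiple of `conj f`. -/
theorem rationalData_cubic (b c : ℂ) (hp : ‖p‖ < 1) (x : Torus) :
    (‖rationalData b c p x‖ : ℂ) ^ 2 * rationalData b c p x
      = (conj b * b ^ 2 + c * conj c / (1 - p * conj p) * (2 * b + c * conj p / (1 - p * conj p)))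
      + (2 * conj b * b * c + c * conj c / (1 - p * conj p)
          * (c + p * (2 * b + c * conj p / (1 - p * conj p)))) * pole p x
      + (conj b * c ^ 2 + c * conj c / (1 - p * conj p) * (p * c)) * pole p x ^ 2
      + conj c * (b + c * conj p / (1 - p * conj p)) ^ 2 * conj (pole p x) := by
  have H := pole_mul_conj hp x
  rw [← Complex.ofReal_pow, ofReal_norm_sq, rationalData_eq]
  simp only [map_add, map_mul]
  -- The term `f² conj f` needs the product identity twice, since its first use produces `f conj f`
  -- again. The last summand of the multiplier accounts for that.
  linear_combination
    conj c * (2 * b * c + c ^ 2 * pole p x + c ^ 2 * conj p / (1 - p * conj p)) * H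

/-- The Fourier coefficients of `|u|² u`. -/
theorem fourierCoeff_rationalData_cubic (b c : ℂ) (hp : ‖p‖ < 1) (k : ℤ) :
    fourierCoeff (fun x ↦ (‖rationalData b c p x‖ : ℂ) ^ 2 * rationalData b c p x) k
      = (if k = 0 then conj b * b ^ 2
          + c * conj c / (1 - p * conj p) * (2 * b + c * conj p / (1 - p * conj p)) else 0)
      + (2 * conj b * b * c + c * conj c / (1 - p * conj p)
          * (c + p * (2 * b + c * conj p / (1 - p * conj p)))) * fourierCoeff (pole p) k
      + (conj b * c ^ 2 + c * conj c / (1 - p * conj p) * (p * c))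
          * fourierCoeff (fun x ↦ pole p x ^ 2) k
      + conj c * (b + c * conj p / (1 - p * conj p)) ^ 2 * conj (fourierCoeff (pole p) (-k)) := by
  have h := continuous_pole hp
  have h' : Continuous fun x ↦ conj (pole p x) := Complex.continuous_conj.comp h
  simp only [rationalData_cubic b c hp]
  rw [← fourierCoeff_conj, ← fourierCoeff_const, ← fourierCoeff.const_mul, ← fourierCoeff.const_mul,
    ← fourierCoeff.const_mul, ← Pi.add_apply (fourierCoeff _), ← fourierCoeff.add,
    ← Pi.add_apply (fourierCoeff _), ← fourierCoeff.add, ← Pi.add_apply (fourierCoeff _),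
    ← fourierCoeff.add]
  · rfl
  all_goals exact integrable_of_continuous (by fun_prop)

end pole

/-! ### Conserved quantities of rational data -/

section invariants

variable {p : ℂ}

theorem delta_pos_of_norm_lt (hp : ‖p‖ < 1) : 0 < 1 - ‖p‖ ^ 2 := by
  nlinarith [norm_nonneg p]

theorem ofReal_delta (p : ℂ) : ((1 - ‖p‖ ^ 2 : ℝ) : ℂ) = 1 - p * conj p := by
  rw [Complex.ofReal_sub, ofReal_norm_sq, Complex.ofReal_one]

theorem integral_eq_fourierCoeff_zero (F : Torus → ℂ) :
    ∫ x, F x ∂haarAddCircle = fourierCoeff F 0 := by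
  simp [fourierCoeff]

theorem mean_rationalData (b c : ℂ) (hp : ‖p‖ < 1) : mean (rationalData b c p) = b := by
  rw [mean, integral_eq_fourierCoeff_zero, fourierCoeff_rationalData_zero b c hp]

theorem integral_pole (hp : ‖p‖ < 1) : ∫ x, pole p x ∂haarAddCircle = 0 := by
  rw [integral_eq_fourierCoeff_zero, fourierCoeff_pole_of_nonpos hp le_rfl]

theorem integral_pole_sq (hp : ‖p‖ < 1) : ∫ x, pole p x ^ 2 ∂haarAddCircle = 0 := by
  rw [integral_eq_fourierCoeff_zero, fourierCoeff_pole_sq_of_nonpos hp le_rfl]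

theorem integral_conj_pole (hp : ‖p‖ < 1) : ∫ x, conj (pole p x) ∂haarAddCircle = 0 := by
  rw [integral_conj, integral_pole hp, map_zero]

theorem integral_conj_pole_sq (hp : ‖p‖ < 1) : ∫ x, conj (pole p x) ^ 2 ∂haarAddCircle = 0 := by
  simp only [← map_pow]
  rw [integral_conj, integral_pole_sq hp, map_zero]

/-- Integrals of quadratic and cubic expressions in `f = z / (1 - p z)` and `conj f`. -/
theorem integral_pole_poly (hp : ‖p‖ < 1) (a₀ a₁ a₂ a₁' a₂' : ℂ) :
    ∫ x, (a₀ + a₁ * pole p x + a₂ * pole p x ^ 2 + a₁' * conj (pole p x)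
      + a₂' * conj (pole p x) ^ 2) ∂haarAddCircle = a₀ := by
  have h := continuous_pole hp
  have h' : Continuous fun x ↦ conj (pole p x) := Complex.continuous_conj.comp h
  rw [integral_add, integral_add, integral_add, integral_add]
  · simp only [integral_const_mul, integral_pole hp, integral_pole_sq hp, integral_conj_pole hp,
      integral_conj_pole_sq hp]
    simp
  all_goals exact integrable_of_continuous (by fun_prop)

theorem mass_rationalData (b c : ℂ) (hp : ‖p‖ < 1) :
    mass (rationalData b c p) = ‖b‖ ^ 2 + ‖c‖ ^ 2 / (1 - ‖p‖ ^ 2) := by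
  have h : ((mass (rationalData b c p) : ℝ) : ℂ)
      = b * conj b + c * conj c / (1 - p * conj p) := by
    rw [mass, ← integral_complex_ofReal]
    simp only [ofReal_norm_sq]
    refine Eq.trans ?_ (integral_pole_poly hp _ (conj b * c + c * conj c / (1 - p * conj p) * p) 0
      (b * conj c + c * conj c / (1 - p * conj p) * conj p) 0)
    congr 1 with x
    rw [rationalData_eq]
    simp only [map_add, map_mul]
    linear_combination c * conj c * pole_mul_conj hp x
  rw [← ofReal_delta, ← ofReal_norm_sq, ← ofReal_norm_sq] at h
  exact_mod_cast h

/-- Write `|u|⁴ = (|u|² u) conj u` and use that positive powers of `f` and of `conj f` have mean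
zero. Only the means `1 / d` of `f conj f` and `conj p / d²` of `f² conj f` contribute, where `d = 1
- |p|²`. -/
theorem integral_rationalData_four (b c : ℂ) (hp : ‖p‖ < 1) :
    ((∫ x, ‖rationalData b c p x‖ ^ 4 ∂haarAddCircle : ℝ) : ℂ)
      = conj b * (conj b * b ^ 2
          + c * conj c / (1 - p * conj p) * (2 * b + c * conj p / (1 - p * conj p)))
        + conj c * ((2 * conj b * b * c + c * conj c / (1 - p * conj p)
          * (c + p * (2 * b + c * conj p / (1 - p * conj p)))) / (1 - p * conj p)
          + (conj b * c ^ 2 + c * conj c / (1 - p * conj p) * (p * c))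
            * (conj p / (1 - p * conj p) ^ 2)) := by
  set d := (1 - p * conj p) with hd
  rw [← integral_complex_ofReal]
  set A := conj b * b ^ 2 + c * conj c / d * (2 * b + c * conj p / d) with hA
  set B := 2 * conj b * b * c + c * conj c / d * (c + p * (2 * b + c * conj p / d)) with hB
  set D := conj b * c ^ 2 + c * conj c / d * (p * c) with hD
  set E := conj c * (b + c * conj p / d) ^ 2 with hE
  refine Eq.trans ?_ (integral_pole_poly hp _
    (conj b * B + conj c * (B * (p / d) + D * (1 / d + p * conj p / d ^ 2)))
    (conj b * D + conj c * D * (p / d)) (conj b * E + conj c * (A + B * (conj p / d)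
      + D * (conj p ^ 2 / d ^ 2))) (conj c * E))
  congr 1 with x
  have h4 : ((‖rationalData b c p x‖ ^ 4 : ℝ) : ℂ)
      = (‖rationalData b c p x‖ : ℂ) ^ 2 * rationalData b c p x * conj (rationalData b c p x) := by
    rw [mul_assoc, ← ofReal_norm_sq]; push_cast; ring
  have H := pole_mul_conj hp x
  rw [← hd] at H
  rw [h4, rationalData_cubic b c hp, ← hd, ← hA, ← hB, ← hD, ← hE,
    rationalData_eq]
  simp only [map_add, map_mul]
  clear_value A B D E d
  linear_combination (conj c * B + conj c * D * pole p x + conj c * D * (conj p / d)) * H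

/-- The energy defect of rational data. -/
theorem energy_rationalData (α : ℝ) (b c : ℂ) (hp : ‖p‖ < 1) :
    energy α (rationalData b c p) - ((1 / 4) * mass (rationalData b c p) ^ 2
      + (α / 2) * mass (rationalData b c p))
      = ‖c‖ ^ 2 / (2 * (1 - ‖p‖ ^ 2))
        * (‖b + c / ((1 - ‖p‖ ^ 2 : ℝ) : ℂ) * conj p‖ ^ 2 - α) := by
  rw [energy, mean_rationalData b c hp, mass_rationalData b c hp]
  have h := integral_rationalData_four b c hp
  have hd := one_sub_mul_conj_ne_zero hp
  rw [← Complex.ofReal_inj]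
  push_cast at h ⊢
  rw [h]
  simp only [← Complex.ofReal_pow, ofReal_norm_sq]
  simp only [map_add, map_mul, map_div₀, map_sub, map_one, Complex.conj_conj]
  have h2 : 1 - conj p * p ≠ 0 := by rwa [mul_comm]
  rw [mul_comm (conj p) p]
  field_simp
  ring

theorem momentum_rationalData (b c : ℂ) (hp : ‖p‖ < 1) :
    momentum (rationalData b c p) = ‖c‖ ^ 2 / (1 - ‖p‖ ^ 2) ^ 2 := by
  have h1 : HasSum (fun n : ℕ ↦ (((n : ℤ) + 1 : ℤ) : ℝ)
      * ‖fourierCoeff (rationalData b c p) ((n : ℤ) + 1)‖ ^ 2) (‖c‖ ^ 2 / (1 - ‖p‖ ^ 2) ^ 2) := by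
    have := (hasSum_choose_mul_geometric_of_norm_lt_one (𝕜 := ℝ) 1 (r := ‖p‖ ^ 2)
      (by rw [Real.norm_of_nonneg (by positivity)]; linarith [delta_pos_of_norm_lt hp])).mul_left
      (‖c‖ ^ 2)
    rw [mul_one_div] at this
    convert! this using 2 with n
    rw [fourierCoeff_rationalData_succ b c hp, norm_mul, norm_pow]
    simp
    ring
  have h2 := hasSum_int_of_nonneg
    (F := fun k ↦ (k : ℝ) * ‖fourierCoeff (rationalData b c p) k‖ ^ 2)
    (fun k hk ↦ by simp [fourierCoeff_rationalData_neg b c hp hk]) h1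
  rw [momentum, h2.tsum_eq]
  simp

end invariants

/-! ### Sobolev norms -/

/-- The weighted geometric series `∑ (1 + (n + 1)²)^s r^n`. -/
noncomputable def weightedGeom (s r : ℝ) : ℝ := ∑' n : ℕ, (1 + ((n : ℝ) + 1) ^ 2) ^ s * r ^ n

/-- In the scale `y = (1 - r)(n + 1)`, the weight is at most `(1 - r)^{-2s} (2 y²)^s` and `rⁿ ≤ e ·
e^{-y}`. Half of this exponential absorbs the power of `y`, and the other half leaves a geometric
sequence. -/
theorem weighted_term_le {s : ℝ} (hs : 0 ≤ s) : ∃ C > 0, ∀ r : ℝ, 0 ≤ r → r < 1 → ∀ n : ℕ,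
    (1 + ((n : ℝ) + 1) ^ 2) ^ s * r ^ n
      ≤ C * ((1 - r)⁻¹) ^ (2 * s) * Real.exp (-((1 - r) / 2)) ^ n := by
  obtain ⟨N, hN⟩ := exists_nat_ge s
  -- The `1` covers `2 y² ≤ 1`. The rest comes from `(y / 2)^{2N} / (2N)! ≤ e^{y/2}`.
  set C₀ : ℝ := 1 + 2 ^ N * ((2 * N).factorial * 2 ^ (2 * N)) with hC₀
  refine ⟨C₀ * Real.exp 1, by positivity, fun r hr0 hr1 n ↦ ?_⟩
  set d := 1 - r with hd
  have hd0 : 0 < d := by linarith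
  set y := d * ((n : ℝ) + 1) with hy
  have hy0 : 0 ≤ y := by positivity
  have h1 : (2 * y ^ 2) ^ s ≤ C₀ * Real.exp (y / 2) := by
    have hE : 1 ≤ Real.exp (y / 2) := Real.one_le_exp (by positivity)
    have h2 : (2 * y ^ 2) ^ s ≤ 1 + (2 * y ^ 2) ^ N := by
      rcases le_total (2 * y ^ 2) 1 with h | h
      · have := Real.rpow_le_one (by positivity) h hs
        have : (0 : ℝ) ≤ (2 * y ^ 2) ^ N := by positivity
        linarith
      · have := Real.rpow_le_rpow_of_exponent_le h hN
        rw [Real.rpow_natCast] at this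
        linarith
    have h3 : (2 * y ^ 2) ^ N ≤ 2 ^ N * ((2 * N).factorial * 2 ^ (2 * N)) * Real.exp (y / 2) := by
      have := Real.pow_div_factorial_le_exp (y / 2) (by positivity) (2 * N)
      rw [div_le_iff₀ (by positivity), div_pow, div_le_iff₀ (by positivity)] at this
      rw [mul_pow, ← pow_mul]
      calc 2 ^ N * y ^ (2 * N)
          ≤ 2 ^ N * (Real.exp (y / 2) * (2 * N).factorial * 2 ^ (2 * N)) := by gcongr
        _ = _ := by ring
    rw [hC₀, add_mul, one_mul]
    linarith
  have h2 : (1 + ((n : ℝ) + 1) ^ 2) ^ s ≤ (d⁻¹) ^ (2 * s) * (2 * y ^ 2) ^ s := by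
    rw [Real.rpow_mul (by positivity), Real.rpow_two, ← Real.mul_rpow (by positivity) (by positivity)]
    refine Real.rpow_le_rpow (by positivity) ?_ hs
    have : (d⁻¹) ^ 2 * (2 * y ^ 2) = 2 * ((n : ℝ) + 1) ^ 2 := by rw [hy]; field_simp
    rw [this]
    nlinarith [(Nat.cast_nonneg n : (0 : ℝ) ≤ n)]
  have h3 : r ^ n ≤ Real.exp 1 * Real.exp (-y) := by
    have : r ≤ Real.exp (-d) := by have := Real.add_one_le_exp (-d); linarith
    calc r ^ n ≤ Real.exp (-d) ^ n := by gcongr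
      _ = Real.exp (-d * n) := by rw [← Real.exp_nat_mul]; ring_nf
      _ ≤ Real.exp (1 + -y) := by
        refine Real.exp_le_exp.2 ?_
        rw [hy]; linarith
      _ = _ := Real.exp_add _ _
  calc (1 + ((n : ℝ) + 1) ^ 2) ^ s * r ^ n
      ≤ ((d⁻¹) ^ (2 * s) * (C₀ * Real.exp (y / 2))) * (Real.exp 1 * Real.exp (-y)) := by
        gcongr
        exact h2.trans (by gcongr)
    _ = C₀ * Real.exp 1 * (d⁻¹) ^ (2 * s) * (Real.exp (y / 2) * Real.exp (-y)) := by ring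
    _ ≤ _ := by
        gcongr
        rw [← Real.exp_add, ← Real.exp_nat_mul]
        refine Real.exp_le_exp.2 ?_
        rw [hy]; linarith

theorem summable_weighted {s : ℝ} (hs : 0 ≤ s) {r : ℝ} (hr0 : 0 ≤ r) (hr1 : r < 1) :
    Summable fun n : ℕ ↦ (1 + ((n : ℝ) + 1) ^ 2) ^ s * r ^ n := by
  obtain ⟨C, -, h⟩ := weighted_term_le hs
  refine Summable.of_nonneg_of_le (fun n ↦ by positivity) (h r hr0 hr1) (Summable.mul_left _ ?_)
  refine summable_geometric_of_lt_one (Real.exp_pos _).le ?_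
  rw [Real.exp_lt_one_iff]
  linarith

theorem weightedGeom_le {s : ℝ} (hs : 0 ≤ s) : ∃ A > 0, ∀ r : ℝ, 0 ≤ r → r < 1 →
    weightedGeom s r ≤ A * ((1 - r)⁻¹) ^ (2 * s + 1) := by
  obtain ⟨C, hC, h⟩ := weighted_term_le hs
  refine ⟨C * 3, by positivity, fun r hr0 hr1 ↦ ?_⟩
  have hd : 0 < 1 - r := by linarith
  set q := Real.exp (-((1 - r) / 2)) with hq
  have hq1 : q < 1 := by rw [hq, Real.exp_lt_one_iff]; linarith
  have hg := hasSum_geometric_of_lt_one (Real.exp_pos _).le hq1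
  have h1 : weightedGeom s r ≤ C * ((1 - r)⁻¹) ^ (2 * s) * (1 - q)⁻¹ :=
    hasSum_le (h r hr0 hr1) (summable_weighted hs hr0 hr1).hasSum (hg.mul_left _)
  have h2 : (1 - q)⁻¹ ≤ 3 * (1 - r)⁻¹ := by
    have h3 : 1 + (1 - r) / 2 ≤ Real.exp ((1 - r) / 2) := by
      have := Real.add_one_le_exp ((1 - r) / 2); linarith
    have h4 : q ≤ (1 + (1 - r) / 2)⁻¹ := by
      rw [hq, Real.exp_neg]
      exact inv_anti₀ (by positivity) h3
    -- With `d = 1 - r ≤ 1`, `(1 + d/2)(1 - d/3) = 1 + d (1 - d) / 6 ≥ 1`.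
    have h5 : (1 + (1 - r) / 2)⁻¹ ≤ 1 - (1 - r) / 3 := by
      rw [inv_le_iff_one_le_mul₀ (by positivity)]
      nlinarith
    rw [inv_le_comm₀ (by linarith) (by positivity), mul_inv, inv_inv]
    linarith
  calc weightedGeom s r ≤ C * ((1 - r)⁻¹) ^ (2 * s) * (1 - q)⁻¹ := h1
    _ ≤ C * ((1 - r)⁻¹) ^ (2 * s) * (3 * (1 - r)⁻¹) := by gcongr
    _ = _ := by rw [Real.rpow_add (by positivity), Real.rpow_one]; ring

/-- Keep only the tail from `K ≈ 1 / (2 (1 - r))`. There the weight is already at least `(2 (1 -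
r))^{-2s}`, while `r^K ≥ 1/2` by Bernoulli, so the tail dominates a geometric series of sum `1 / (1
- r)`. -/
theorem le_weightedGeom {s : ℝ} (hs : 0 ≤ s) : ∃ A > 0, ∀ r : ℝ, 0 ≤ r → r < 1 →
    A * ((1 - r)⁻¹) ^ (2 * s + 1) ≤ weightedGeom s r := by
  refine ⟨(1 / 2) ^ (2 * s) * (1 / 2), by positivity, fun r hr0 hr1 ↦ ?_⟩
  set d := 1 - r with hd
  have hd0 : 0 < d := by linarith
  set K := ⌊(2 * d)⁻¹⌋₊ with hK
  have hK1 : (K : ℝ) ≤ (2 * d)⁻¹ := Nat.floor_le (by positivity)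
  have hK2 : (2 * d)⁻¹ < K + 1 := Nat.lt_floor_add_one _
  have hrK : 1 / 2 ≤ r ^ K := by
    have h1 := one_add_mul_le_pow (a := -d) (by linarith) K
    have h2 : (K : ℝ) * d ≤ 1 / 2 := by
      calc (K : ℝ) * d ≤ (2 * d)⁻¹ * d := by gcongr
        _ = 1 / 2 := by field_simp
    have h3 : (1 + -d) = r := by rw [hd]; ring
    rw [h3] at h1
    linarith
  have hsum := summable_weighted hs hr0 hr1
  have h1 : ∑' n : ℕ, (1 + (((n + K : ℕ) : ℝ) + 1) ^ 2) ^ s * r ^ (n + K) ≤ weightedGeom s r := by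
    rw [weightedGeom, ← hsum.sum_add_tsum_nat_add K]
    exact le_add_of_nonneg_left (Finset.sum_nonneg fun n _ ↦ by positivity)
  refine le_trans ?_ h1
  have h2 := (hasSum_geometric_of_lt_one hr0 hr1).mul_left (((2 * d)⁻¹) ^ (2 * s) * (1 / 2))
  have h3 : (1 / 2 : ℝ) ^ (2 * s) * (1 / 2) * (d⁻¹) ^ (2 * s + 1)
      = ((2 * d)⁻¹) ^ (2 * s) * (1 / 2) * (1 - r)⁻¹ := by
    rw [Real.rpow_add (by positivity), Real.rpow_one, mul_inv,
      Real.mul_rpow (by positivity) (by positivity), one_div]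
    ring
  rw [h3]
  refine hasSum_le (fun n ↦ ?_) h2 ((summable_nat_add_iff K).2 hsum).hasSum
  rw [pow_add, Real.rpow_mul (by positivity), Real.rpow_two]
  have h4 : ((2 * d)⁻¹) ^ 2 ≤ 1 + (((n + K : ℕ) : ℝ) + 1) ^ 2 := by
    have : (2 * d)⁻¹ ≤ ((n + K : ℕ) : ℝ) + 1 := by
      push_cast; linarith [(Nat.cast_nonneg n : (0 : ℝ) ≤ n)]
    have := pow_le_pow_left₀ (by positivity) this 2
    linarith
  calc (((2 * d)⁻¹) ^ 2) ^ s * (1 / 2) * r ^ n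
      ≤ (1 + (((n + K : ℕ) : ℝ) + 1) ^ 2) ^ s * r ^ K * r ^ n := by gcongr
    _ = _ := by ring

/-- The element of `L²` given by `b + c z / (1 - p z)`. -/
noncomputable def rationalLp (b c : ℂ) {p : ℂ} (hp : ‖p‖ < 1) : L2 :=
  ContinuousMap.toLp 2 haarAddCircle ℂ ⟨rationalData b c p, continuous_rationalData b c hp⟩

section rationalLp

variable {p : ℂ}

theorem coeFn_rationalLp (b c : ℂ) (hp : ‖p‖ < 1) :
    rationalLp b c hp =ᵐ[haarAddCircle] rationalData b c p :=
  ContinuousMap.coeFn_toLp _ _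

theorem fourierCoeff_rationalLp (b c : ℂ) (hp : ‖p‖ < 1) :
    fourierCoeff (rationalLp b c hp) = fourierCoeff (rationalData b c p) :=
  fourierCoeff_congr_ae (coeFn_rationalLp b c hp)

theorem hasSum_hs_rationalLp (b c : ℂ) (hp : ‖p‖ < 1) {s : ℝ} (hs : 0 ≤ s) :
    HasSum (fun k : ℤ ↦ (1 + (k : ℝ) ^ 2) ^ s * ‖fourierCoeff (rationalLp b c hp) k‖ ^ 2)
      (‖b‖ ^ 2 + ‖c‖ ^ 2 * weightedGeom s (‖p‖ ^ 2)) := by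
  rw [fourierCoeff_rationalLp]
  have h1 := ((summable_weighted hs (sq_nonneg ‖p‖)
    (by linarith [delta_pos_of_norm_lt hp])).hasSum).mul_left (‖c‖ ^ 2)
  have h2 := hasSum_int_of_nonneg
    (F := fun k : ℤ ↦ (1 + (k : ℝ) ^ 2) ^ s * ‖fourierCoeff (rationalData b c p) k‖ ^ 2)
    (fun k hk ↦ by simp [fourierCoeff_rationalData_neg b c hp hk])
    (S := ‖c‖ ^ 2 * weightedGeom s (‖p‖ ^ 2)) (by
      convert! h1 using 2 with n
      rw [fourierCoeff_rationalData_succ b c hp, norm_mul, norm_pow]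
      push_cast
      ring)
  simpa [fourierCoeff_rationalData_zero b c hp] using h2

theorem memHs_rationalLp (b c : ℂ) (hp : ‖p‖ < 1) {s : ℝ} (hs : 0 ≤ s) :
    MemHs s (rationalLp b c hp) := (hasSum_hs_rationalLp b c hp hs).summable

end rationalLp

theorem fourierCoeff_L2_sub (f g : L2) (k : ℤ) :
    fourierCoeff (f - g : L2) k = fourierCoeff f k - fourierCoeff g k := by
  simp only [← fourierBasis_repr, map_sub]
  rfl

/-! ### The explicit solution -/

/-- The function attached to a solution of the reduced system. -/
noncomputable def IsReduced.sol {α : ℝ} {b m p : ℝ → ℂ} (h : IsReduced α b m p) (t : ℝ) : L2 :=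
  rationalLp (b t) (m t * (1 - p t * conj (p t))) (h.p_lt t)

namespace IsReduced

variable {α : ℝ} {b m p : ℝ → ℂ}

theorem continuous_b (h : IsReduced α b m p) : Continuous b := h.orbit.continuous_b

theorem continuous_p (h : IsReduced α b m p) : Continuous p := h.orbit.continuous_p

theorem continuous_c (h : IsReduced α b m p) :
    Continuous fun t ↦ m t * (1 - p t * conj (p t)) := by
  have := h.orbit.continuous_m
  have := h.continuous_p
  have := Complex.continuous_conj
  fun_prop

/-- For times near `t`, `|p|` stays below a fixed `ρ < 1`. The coefficients are then dominated by
one geometric sequence, summable against any Sobolev weight, and dominated convergence applies mode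
by mode. -/
theorem tendsto_hsNorm_sub (h : IsReduced α b m p) {s : ℝ} (hs : 0 ≤ s) (t : ℝ) :
    Tendsto (fun τ ↦ hsNorm s (h.sol τ - h.sol t)) (𝓝 t) (𝓝 0) := by
  set c := fun t ↦ m t * (1 - p t * conj (p t)) with hc
  obtain ⟨ρ, hρ1, hρ2⟩ := exists_between (h.p_lt t)
  have hρ0 : 0 ≤ ρ := (norm_nonneg _).trans hρ1.le
  have hsum : Summable fun n : ℕ ↦ (1 + ((n : ℝ) + 1) ^ 2) ^ s
      * ((2 * (‖c t‖ + 1)) ^ 2 * (ρ ^ 2) ^ n) := by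
    have := (summable_weighted hs (sq_nonneg ρ) (by nlinarith)).mul_left ((2 * (‖c t‖ + 1)) ^ 2)
    refine this.congr fun n ↦ by ring
  have hbd : ∀ᶠ τ in 𝓝 t, ∀ n : ℕ, ‖c τ * p τ ^ n - c t * p t ^ n‖ ^ 2
      ≤ (2 * (‖c t‖ + 1)) ^ 2 * (ρ ^ 2) ^ n := by
    have e1 : ∀ᶠ τ in 𝓝 t, ‖p τ‖ < ρ :=
      (h.continuous_p.norm.tendsto t).eventually (gt_mem_nhds hρ1)
    have e2 : ∀ᶠ τ in 𝓝 t, ‖c τ‖ < ‖c t‖ + 1 :=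
      (h.continuous_c.norm.tendsto t).eventually (gt_mem_nhds (lt_add_one _))
    filter_upwards [e1, e2] with τ h1 h2 n
    rw [← pow_mul, mul_comm 2 n, pow_mul, ← mul_pow]
    refine pow_le_pow_left₀ (norm_nonneg _) ((norm_sub_le _ _).trans ?_) 2
    rw [norm_mul (c τ), norm_mul (c t), norm_pow, norm_pow, two_mul, add_mul]
    gcongr
    linarith
  have hform : ∀ᶠ τ in 𝓝 t, hsNorm s (h.sol τ - h.sol t) = Real.sqrt (‖b τ - b t‖ ^ 2
      + ∑' n : ℕ, (1 + ((n : ℝ) + 1) ^ 2) ^ s * ‖c τ * p τ ^ n - c t * p t ^ n‖ ^ 2) := by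
    filter_upwards [hbd] with τ hτ
    have h1 : Summable fun n : ℕ ↦ (1 + ((n : ℝ) + 1) ^ 2) ^ s
        * ‖c τ * p τ ^ n - c t * p t ^ n‖ ^ 2 :=
      hsum.of_nonneg_of_le (fun n ↦ by positivity)
        fun n ↦ mul_le_mul_of_nonneg_left (hτ n) (by positivity)
    have h2 := hasSum_int_of_nonneg
      (F := fun k : ℤ ↦ (1 + (k : ℝ) ^ 2) ^ s * ‖fourierCoeff (h.sol τ - h.sol t : L2) k‖ ^ 2)
      (fun k hk ↦ by
        simp only [fourierCoeff_L2_sub, sol, fourierCoeff_rationalLp,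
          fourierCoeff_rationalData_neg _ _ (h.p_lt _) hk]
        simp)
      (by
        convert! h1.hasSum using 2 with n
        rw [fourierCoeff_L2_sub, sol, sol, fourierCoeff_rationalLp, fourierCoeff_rationalLp,
          fourierCoeff_rationalData_succ, fourierCoeff_rationalData_succ]
        push_cast
        · rfl
        · exact h.p_lt t
        · exact h.p_lt τ)
    rw [hsNorm, h2.tsum_eq]
    simp only [fourierCoeff_L2_sub, sol, fourierCoeff_rationalLp,
      fourierCoeff_rationalData_zero _ _ (h.p_lt _)]
    simp
  refine Tendsto.congr' (hform.mono fun τ hτ ↦ hτ.symm) ?_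
  have hlim : Tendsto (fun τ ↦ ∑' n : ℕ, (1 + ((n : ℝ) + 1) ^ 2) ^ s
      * ‖c τ * p τ ^ n - c t * p t ^ n‖ ^ 2) (𝓝 t) (𝓝 (∑' _ : ℕ, 0)) := by
    refine tendsto_tsum_of_dominated_convergence hsum (fun n ↦ ?_) ?_
    · have hcont : Continuous fun τ ↦ (1 + ((n : ℝ) + 1) ^ 2) ^ s
          * ‖c τ * p τ ^ n - c t * p t ^ n‖ ^ 2 := by
        have := h.continuous_c
        have := h.continuous_p
        fun_prop
      simpa using hcont.tendsto t
    · filter_upwards [hbd] with τ hτ n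
      rw [Real.norm_of_nonneg (by positivity)]
      exact mul_le_mul_of_nonneg_left (hτ n) (by positivity)
  have hb : Tendsto (fun τ ↦ ‖b τ - b t‖ ^ 2) (𝓝 t) (𝓝 0) := by
    have hcont : Continuous fun τ ↦ ‖b τ - b t‖ ^ 2 := by
      have := h.continuous_b
      fun_prop
    simpa using hcont.tendsto t
  simpa using (hb.add hlim).sqrt

/-- On nonnegative modes the `conj f` part of the cubic term vanishes, including at mode zero. The
functions `1`, `f`, `f²` are the derivatives of the ansatz in `b` and `c`, and in `p` up to the
factor `c`, so comparing coefficients of modes `0` and `n + 1` reproduces `field`. -/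
theorem isSolution (h : IsReduced α b m p) {u₀ : Torus → ℂ}
    (h0 : u₀ = rationalData (b 0) (m 0 * (1 - p 0 * conj (p 0))) (p 0)) :
    IsSolution α u₀ h.sol where
  memHs t := memHs_rationalLp _ _ _ (by norm_num)
  hardy t k hk := by
    rw [sol, fourierCoeff_rationalLp, fourierCoeff_rationalData_neg _ _ (h.p_lt t) hk]
  continuous t := h.tendsto_hsNorm_sub (by norm_num) t
  initial := by rw [h0]; exact coeFn_rationalLp _ _ _
  equation k t := by
    have hmean : mean (h.sol t) = b t := by
      rw [← mean_rationalData (b t) (m t * (1 - p t * conj (p t))) (h.p_lt t)]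
      exact integral_congr_ae (coeFn_rationalLp _ _ _)
    have hcub : fourierCoeff (fun x ↦ (‖h.sol t x‖ : ℂ) ^ 2 * h.sol t x)
        = fourierCoeff (fun x ↦ (‖rationalData (b t) (m t * (1 - p t * conj (p t))) (p t) x‖ : ℂ) ^ 2
          * rationalData (b t) (m t * (1 - p t * conj (p t))) (p t) x) := by
      refine fourierCoeff_congr_ae ?_
      filter_upwards [coeFn_rationalLp (b t) (m t * (1 - p t * conj (p t))) (h.p_lt t)] with x hx
      rw [sol, hx]
    have hd := one_sub_mul_conj_ne_zero (h.p_lt t)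
    have hd' : 1 - conj (p t) * p t ≠ 0 := by rwa [mul_comm]
    rw [szegoCoeff, hcub, hmean, fourierCoeff_rationalData_cubic _ _ (h.p_lt t),
      fourierCoeff_const]
    simp only [sol, fourierCoeff_rationalLp]
    rcases lt_trichotomy k 0 with hk | rfl | hk
    · simp only [fourierCoeff_rationalData_neg _ _ (h.p_lt _) hk, if_neg (not_le.2 hk), if_neg hk.ne,
        mul_zero, add_zero]
      exact hasDerivAt_const _ _
    · simp only [fourierCoeff_rationalData_zero _ _ (h.p_lt _), neg_zero,
        fourierCoeff_pole_of_nonpos (h.p_lt t) le_rfl,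
        fourierCoeff_pole_sq_of_nonpos (h.p_lt t) le_rfl, map_zero, mul_zero, add_zero, le_refl,
        if_true]
      convert! h.hb t using 1
      simp only [field, map_mul, map_sub, map_one, Complex.conj_conj]
      rw [mul_comm (conj (p t)) (p t)]
      field_simp
    · obtain ⟨n, rfl⟩ : ∃ n : ℕ, k = n + 1 := ⟨(k - 1).toNat, by omega⟩
      simp only [fourierCoeff_rationalData_succ _ _ (h.p_lt _), if_pos hk.le, if_neg hk.ne',
        fourierCoeff_pole_succ (h.p_lt t), fourierCoeff_pole_sq_succ (h.p_lt t),
        fourierCoeff_pole_of_nonpos (h.p_lt t) (neg_nonpos.2 hk.le), map_zero, mul_zero, add_zero,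
        zero_add]
      have hder := ((h.hm t).mul (((h.hp t).mul (hasDerivAt_conj (h.hp t))).const_sub 1)).mul
        ((h.hp t).pow n)
      convert! hder using 1
      simp only [field, map_mul, map_add, map_sub, map_neg, map_one, Complex.conj_I,
        Complex.conj_conj, Pi.mul_apply, Pi.pow_apply]
      rw [mul_comm (conj (p t)) (p t)]
      field_simp
      ring

end IsReduced

/-! ### The quartic estimate on the Hardy space -/

theorem hasSum_nat_of_int {E : Type*} [AddCommMonoid E] [TopologicalSpace E] {F : ℤ → E}
    (hneg : ∀ k < 0, F k = 0) {S : E} : HasSum F S ↔ HasSum (fun n : ℕ ↦ F n) S := by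
  refine (Function.Injective.hasSum_iff Nat.cast_injective fun k hk ↦ hneg k ?_).symm
  by_contra! hk'
  exact hk ⟨k.toNat, by simpa using hk'⟩

theorem hasSum_sq_fourierCoeff_norm (f : L2) :
    HasSum (fun k ↦ ‖fourierCoeff f k‖ ^ 2) (‖f‖ ^ 2) := by
  simp_rw [← fourierBasis_repr]
  have h : HasSum (fun i ↦ ‖fourierBasis.repr f i‖ ^ 2) (‖fourierBasis.repr f‖ ^ 2) := by
    apply_mod_cast lp.hasSum_norm ?_ (fourierBasis.repr f)
    simp
  rwa [LinearIsometryEquiv.norm_map] at h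

theorem L2_norm_sq (f : L2) : ‖f‖ ^ 2 = ∫ x, ‖f x‖ ^ 2 ∂haarAddCircle :=
  (hasSum_sq_fourierCoeff_norm f).unique (hasSum_sq_fourierCoeff f)

open Polynomial in
theorem fourierCoeff_polynomial (P : ℂ[X]) (k : ℤ) :
    fourierCoeff (fun x : Torus ↦ P.eval (fourier 1 x)) k
      = if 0 ≤ k then P.coeff k.toNat else 0 := by
  have h0 : ∀ n ∉ P.support, P.coeff n = 0 := fun n hn ↦ notMem_support_iff.1 hn
  refine fourierCoeff_of_hasSum (summable_of_ne_finset_zero (s := P.support) fun n hn ↦ ?_)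
    (fun x ↦ ?_) k
  · rw [h0 n hn, norm_zero]
  · rw [eval_eq_sum, Polynomial.sum]
    exact hasSum_sum_of_ne_finset_zero fun n hn ↦ by rw [h0 n hn, zero_mul]

open Polynomial in
theorem parseval_polynomial (P : ℂ[X]) : HasSum (fun n : ℕ ↦ ‖P.coeff n‖ ^ 2)
    (∫ x : Torus, ‖P.eval (fourier 1 x)‖ ^ 2 ∂haarAddCircle) := by
  have hc : Continuous fun x : Torus ↦ P.eval (fourier 1 x) :=
    P.continuous.comp (fourier 1 : C(Torus, ℂ)).continuous
  set f : L2 := ContinuousMap.toLp 2 haarAddCircle ℂ ⟨_, hc⟩ with hf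
  have hfe : f =ᵐ[haarAddCircle] fun x ↦ P.eval (fourier 1 x) := ContinuousMap.coeFn_toLp _ _
  have h := hasSum_sq_fourierCoeff f
  rw [fourierCoeff_congr_ae hfe, hasSum_nat_of_int (fun k hk ↦ by
    rw [fourierCoeff_polynomial, if_neg (not_le.2 hk)]; simp)] at h
  simp only [fourierCoeff_polynomial, Nat.cast_nonneg, if_true, Int.toNat_natCast] at h
  convert! h using 1
  refine integral_congr_ae ?_
  filter_upwards [hfe] with x hx
  rw [hx]

-- By Parseval, the integral is the sum of `|∑_{k+l=n} a_k a_l|²`. Cauchy–Schwarz over the `n + 1`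
-- pairs costs a factor `n + 1 ≤ (k + 1) + (l + 1)`, which splits into two Cauchy products.
open Polynomial in
theorem integral_polynomial_four_le (P : ℂ[X]) :
    ∫ x : Torus, ‖P.eval (fourier 1 x)‖ ^ 4 ∂haarAddCircle
      ≤ 2 * (∑' n : ℕ, ‖P.coeff n‖ ^ 2) * ∑' n : ℕ, ((n : ℝ) + 1) * ‖P.coeff n‖ ^ 2 := by
  have h := parseval_polynomial (P ^ 2)
  simp only [eval_pow, norm_pow, ← pow_mul] at h
  norm_num [-fourier_apply] at h
  set f : ℕ → ℝ := fun n ↦ ‖P.coeff n‖ ^ 2 with hf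
  set g : ℕ → ℝ := fun n ↦ ((n : ℝ) + 1) * ‖P.coeff n‖ ^ 2 with hg
  have h0 : ∀ n ∉ P.support, P.coeff n = 0 := fun n hn ↦ notMem_support_iff.1 hn
  have hfs : Summable fun n ↦ ‖f n‖ := summable_of_ne_finset_zero (s := P.support) fun n hn ↦ by
    simp [hf, h0 n hn]
  have hgs : Summable fun n ↦ ‖g n‖ := summable_of_ne_finset_zero (s := P.support) fun n hn ↦ by
    simp [hg, h0 n hn]
  have e1 := tsum_mul_tsum_eq_tsum_sum_antidiagonal_of_summable_norm hfs hgs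
  have e2 := tsum_mul_tsum_eq_tsum_sum_antidiagonal_of_summable_norm hgs hfs
  have s1 := (summable_norm_sum_mul_antidiagonal_of_summable_norm hfs hgs).of_norm
  have s2 := (summable_norm_sum_mul_antidiagonal_of_summable_norm hgs hfs).of_norm
  have key : ∀ n, ‖(P ^ 2).coeff n‖ ^ 2 ≤ (∑ kl ∈ Finset.HasAntidiagonal.antidiagonal n, f kl.1 * g kl.2)
      + ∑ kl ∈ Finset.HasAntidiagonal.antidiagonal n, g kl.1 * f kl.2 := by
    intro n
    rw [sq P, coeff_mul]
    calc ‖∑ x ∈ Finset.HasAntidiagonal.antidiagonal n, P.coeff x.1 * P.coeff x.2‖ ^ 2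
        ≤ (∑ x ∈ Finset.HasAntidiagonal.antidiagonal n, ‖P.coeff x.1 * P.coeff x.2‖) ^ 2 :=
          pow_le_pow_left₀ (norm_nonneg _) (norm_sum_le _ _) 2
      _ ≤ ((Finset.HasAntidiagonal.antidiagonal n).card : ℝ)
            * ∑ x ∈ Finset.HasAntidiagonal.antidiagonal n, ‖P.coeff x.1 * P.coeff x.2‖ ^ 2 :=
          sq_sum_le_card_mul_sum_sq
      _ ≤ _ := by
          rw [Finset.mul_sum, ← Finset.sum_add_distrib]
          refine Finset.sum_le_sum fun x hx ↦ ?_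
          rw [Finset.Nat.card_antidiagonal, ← Finset.HasAntidiagonal.mem_antidiagonal.1 hx, norm_mul, mul_pow]
          simp only [hf, hg]
          push_cast
          have : 0 ≤ ‖P.coeff x.1‖ ^ 2 * ‖P.coeff x.2‖ ^ 2 := by positivity
          nlinarith
  have := hasSum_le key h (s1.hasSum.add s2.hasSum)
  rw [← e1, ← e2] at this
  linarith

/-- The truncation of the Fourier series of `f` to the modes `0 ≤ k < N`. -/
noncomputable def trunc (f : L2) (N : ℕ) : L2 :=
  ∑ k ∈ Finset.range N, fourierCoeff f k • fourierLp 2 (k : ℤ)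

theorem coeFn_trunc (f : L2) (N : ℕ) : trunc f N =ᵐ[haarAddCircle]
    fun x ↦ ∑ k ∈ Finset.range N, fourierCoeff f k * fourier (k : ℤ) x := by
  have h1 : ∀ k : ℕ, (fourierCoeff f k • fourierLp 2 (k : ℤ) : L2) =ᵐ[haarAddCircle]
      fun x ↦ fourierCoeff f k * fourier (k : ℤ) x := fun k ↦ by
    filter_upwards [Lp.coeFn_smul (fourierCoeff f k) (fourierLp 2 (k : ℤ) : L2),
      coeFn_fourierLp (T := 2 * Real.pi) 2 (k : ℤ)] with x h1 h2
    rw [h1, Pi.smul_apply, h2, smul_eq_mul]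
  induction N with
  | zero =>
    simp only [trunc, Finset.range_zero, Finset.sum_empty]
    exact Lp.coeFn_zero _ _ _
  | succ N ih =>
    have e : trunc f (N + 1) = trunc f N + fourierCoeff f N • fourierLp 2 (N : ℤ) :=
      Finset.sum_range_succ _ _
    filter_upwards [Lp.coeFn_add (trunc f N) (fourierCoeff f N • fourierLp 2 (N : ℤ)), ih, h1 N]
      with x h2 h3 h4
    rw [e, h2, Pi.add_apply, h3, h4, Finset.sum_range_succ]

theorem fourierCoeff_trunc (f : L2) (N : ℕ) (k : ℤ) :
    fourierCoeff (trunc f N) k = if 0 ≤ k ∧ k < N then fourierCoeff f k else 0 := by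
  rw [fourierCoeff_congr_ae (coeFn_trunc f N)]
  have := congrFun (fourierCoeff.sum (Finset.range N)
    (fun n x ↦ fourierCoeff f n * fourier (n : ℤ) x : ℕ → Torus → ℂ) fun n _ ↦
      integrable_of_continuous (by
        have := (fourier (n : ℤ) : C(Torus, ℂ)).continuous
        fun_prop)) k
  rw [Finset.sum_fn] at this
  rw [this, Finset.sum_apply]
  simp only [fourierCoeff.const_mul]
  have h2 : ∀ n : ℕ, fourierCoeff (fun x : Torus ↦ fourier (n : ℤ) x) k = if k = n then 1 else 0 := by
    intro n
    rw [show (fun x : Torus ↦ fourier (n : ℤ) x) = fourier (n : ℤ) from rfl, fourierCoeff_fourier,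
      Pi.single_apply]
  simp only [h2, mul_ite, mul_one, mul_zero]
  split_ifs with hk
  · lift k to ℕ using hk.1
    rw [Finset.sum_eq_single k]
    · simp
    · intro n _ hn
      rw [if_neg]
      omega
    · intro h
      exact absurd (by exact_mod_cast hk.2) (by simpa using h)
  · refine Finset.sum_eq_zero fun n hn ↦ if_neg ?_
    rintro rfl
    exact hk ⟨by positivity, by simpa using hn⟩

theorem IsHardy.tendsto_trunc {f : L2} (hf : IsHardy f) :
    Tendsto (trunc f) atTop (𝓝 f) := by
  have h := hasSum_fourier_series_L2 f
  rw [hasSum_nat_of_int (fun k hk ↦ by rw [hf k hk, zero_smul])] at h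
  exact h.tendsto_sum_nat

theorem IsHardy.trunc (f : L2) (N : ℕ) : IsHardy (trunc f N) := fun k hk ↦ by
  rw [fourierCoeff_trunc, if_neg (by omega)]

theorem hsNorm_sq {s : ℝ} (f : L2) :
    hsNorm s f ^ 2 = ∑' k : ℤ, (1 + (k : ℝ) ^ 2) ^ s * ‖fourierCoeff f k‖ ^ 2 :=
  Real.sq_sqrt (tsum_nonneg fun k ↦ by positivity)

theorem hsNorm_nonneg (s : ℝ) (f : L2) : 0 ≤ hsNorm s f := Real.sqrt_nonneg _

theorem norm_le_hsNorm {s : ℝ} (hs : 0 ≤ s) {f : L2} (hf : MemHs s f) : ‖f‖ ≤ hsNorm s f := by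
  refine le_of_sq_le_sq ?_ (hsNorm_nonneg s f)
  rw [hsNorm_sq]
  refine hasSum_le (fun k ↦ ?_) (hasSum_sq_fourierCoeff_norm f) hf.hasSum
  refine le_mul_of_one_le_left (by positivity) (Real.one_le_rpow ?_ hs)
  nlinarith [sq_nonneg (k : ℝ)]

/-- The truncation is a polynomial in `z` whose coefficients are among those of `f`, so the bound is
uniform in `N`. The constant is `2 · 2`, from the polynomial estimate and `n + 1 ≤ 2 √(1 + n²)`. -/
theorem integral_trunc_four_le {f : L2} (hf : IsHardy f) (hs : MemHs (1 / 2) f) (N : ℕ) :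
    ∫ x, ‖trunc f N x‖ ^ 4 ∂haarAddCircle ≤ 4 * ‖f‖ ^ 2 * hsNorm (1 / 2) f ^ 2 := by
  set P : Polynomial ℂ := ∑ k ∈ Finset.range N, Polynomial.C (fourierCoeff f k) * Polynomial.X ^ k
    with hP
  have hcoeff : ∀ n : ℕ, P.coeff n = if n < N then fourierCoeff f n else 0 := by
    intro n
    simp [hP, Polynomial.coeff_C_mul, Polynomial.coeff_X_pow]
  have hle : ∀ n : ℕ, ‖P.coeff n‖ ^ 2 ≤ ‖fourierCoeff f n‖ ^ 2 := by
    intro n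
    rw [hcoeff]
    split_ifs
    · rfl
    · simp
  have h1 : ∫ x, ‖trunc f N x‖ ^ 4 ∂haarAddCircle
      = ∫ x : Torus, ‖P.eval (fourier 1 x)‖ ^ 4 ∂haarAddCircle := by
    refine integral_congr_ae ?_
    filter_upwards [coeFn_trunc f N] with x hx
    rw [hx, hP, Polynomial.eval_finsetSum]
    simp only [Polynomial.eval_mul, Polynomial.eval_C, Polynomial.eval_pow, Polynomial.eval_X,
      fourier_natCast]
  rw [h1]
  have hsN : HasSum (fun n : ℕ ↦ (1 + (n : ℝ) ^ 2) ^ (1 / 2 : ℝ) * ‖fourierCoeff f n‖ ^ 2)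
      (hsNorm (1 / 2) f ^ 2) := by
    have h := hs.hasSum
    rw [← hsNorm_sq, hasSum_nat_of_int (fun k hk ↦ by rw [hf k hk]; simp)] at h
    simpa using h
  have hqN := hasSum_sq_fourierCoeff_norm f
  rw [hasSum_nat_of_int (fun k hk ↦ by rw [hf k hk]; simp)] at hqN
  have h2 : ∑' n : ℕ, ‖P.coeff n‖ ^ 2 ≤ ‖f‖ ^ 2 := by
    rw [← hqN.tsum_eq]
    exact Summable.tsum_le_tsum hle (hqN.summable.of_nonneg_of_le (fun n ↦ by positivity) hle)
      hqN.summable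
  have h3 : ∑' n : ℕ, ((n : ℝ) + 1) * ‖P.coeff n‖ ^ 2 ≤ 2 * hsNorm (1 / 2) f ^ 2 := by
    have hle' : ∀ n : ℕ, ((n : ℝ) + 1) * ‖P.coeff n‖ ^ 2
        ≤ 2 * ((1 + (n : ℝ) ^ 2) ^ (1 / 2 : ℝ) * ‖fourierCoeff f n‖ ^ 2) := by
      intro n
      rw [← mul_assoc]
      refine mul_le_mul ?_ (hle n) (by positivity) (by positivity)
      rw [← Real.sqrt_eq_rpow]
      have e1 : (n : ℝ) ≤ Real.sqrt (1 + (n : ℝ) ^ 2) := Real.le_sqrt_of_sq_le (by linarith)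
      have e2 : 1 ≤ Real.sqrt (1 + (n : ℝ) ^ 2) :=
        Real.le_sqrt_of_sq_le (by nlinarith [sq_nonneg (n : ℝ)])
      linarith
    have hs2 := hsN.mul_left 2
    rw [← hs2.tsum_eq]
    exact Summable.tsum_le_tsum hle' (hs2.summable.of_nonneg_of_le (fun n ↦ by positivity) hle')
      hs2.summable
  calc _ ≤ _ := integral_polynomial_four_le P
    _ ≤ 2 * ‖f‖ ^ 2 * (2 * hsNorm (1 / 2) f ^ 2) := by
      gcongr
    _ = _ := by ring

theorem integrable_trunc_four (f : L2) (N : ℕ) :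
    Integrable (fun x ↦ ‖trunc f N x‖ ^ 4) haarAddCircle := by
  have hc : Continuous fun x : Torus ↦
      ‖∑ k ∈ Finset.range N, fourierCoeff f k * fourier (k : ℤ) x‖ ^ 4 := by
    have : ∀ k : ℕ, Continuous fun x : Torus ↦ fourier (k : ℤ) x := fun k ↦
      (fourier (k : ℤ) : C(Torus, ℂ)).continuous
    fun_prop
  refine (hc.integrable_of_hasCompactSupport (HasCompactSupport.of_compactSpace _)).congr ?_
  filter_upwards [coeFn_trunc f N] with x hx
  rw [hx]

/-- The Gagliardo–Nirenberg inequality `‖f‖_{L⁴}⁴ ≤ 4 ‖f‖_{L²}² ‖f‖_{H^{1/2}}²` on the Hardy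
space. -/
theorem integral_four_le {f : L2} (hf : IsHardy f) (hs : MemHs (1 / 2) f) :
    Integrable (fun x ↦ ‖f x‖ ^ 4) haarAddCircle ∧
      ∫ x, ‖f x‖ ^ 4 ∂haarAddCircle ≤ 4 * ‖f‖ ^ 2 * hsNorm (1 / 2) f ^ 2 := by
  set B := 4 * ‖f‖ ^ 2 * hsNorm (1 / 2) f ^ 2 with hB
  have hB0 : 0 ≤ B := by positivity
  -- Convergence in `L²` gives an almost everywhere convergent subsequence, and Fatou transfers the
  -- uniform quartic bound to `f`.
  have hmeas : TendstoInMeasure haarAddCircle (fun N x ↦ trunc f N x) atTop f :=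
    tendstoInMeasure_of_tendsto_Lp hf.tendsto_trunc
  obtain ⟨ns, -, hns⟩ := hmeas.exists_seq_tendsto_ae
  have hm : AEStronglyMeasurable (fun x ↦ ‖f x‖ ^ 4) haarAddCircle :=
    (Lp.aestronglyMeasurable f).norm.pow 4
  have hlim : ∫⁻ x, ENNReal.ofReal (‖f x‖ ^ 4) ∂haarAddCircle ≤ ENNReal.ofReal B := by
    have e1 : ∀ᵐ x ∂(haarAddCircle : Measure Torus),
        liminf (fun i ↦ ENNReal.ofReal (‖trunc f (ns i) x‖ ^ 4)) atTop
          = ENNReal.ofReal (‖f x‖ ^ 4) := by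
      filter_upwards [hns] with x hx
      exact (ENNReal.tendsto_ofReal (hx.norm.pow 4)).liminf_eq
    rw [← lintegral_congr_ae e1]
    refine (lintegral_liminf_le' fun i ↦ ?_).trans ?_
    · exact ((Lp.aestronglyMeasurable (trunc f (ns i))).norm.pow 4).aemeasurable.ennreal_ofReal
    · refine liminf_le_of_frequently_le' (Frequently.of_forall fun i ↦ ?_)
      rw [← ofReal_integral_eq_lintegral_ofReal (integrable_trunc_four f _)
        (ae_of_all _ fun x ↦ by positivity)]
      exact ENNReal.ofReal_le_ofReal (integral_trunc_four_le hf hs _)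
  have hint : Integrable (fun x ↦ ‖f x‖ ^ 4) haarAddCircle := by
    refine ⟨hm, ?_⟩
    rw [hasFiniteIntegral_iff_ofReal (ae_of_all _ fun x ↦ by positivity)]
    exact hlim.trans_lt ENNReal.ofReal_lt_top
  refine ⟨hint, ?_⟩
  rwa [← ofReal_integral_eq_lintegral_ofReal hint (ae_of_all _ fun x ↦ by positivity),
    ENNReal.ofReal_le_ofReal_iff hB0] at hlim

/-! ### Uniqueness -/

theorem IsHardy.sub {f g : L2} (hf : IsHardy f) (hg : IsHardy g) : IsHardy (f - g) := fun k hk ↦ by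
  rw [fourierCoeff_L2_sub, hf k hk, hg k hk, sub_zero]

theorem norm_sub_sq_le_two_mul {E : Type*} [SeminormedAddCommGroup E] (a b : E) :
    ‖a - b‖ ^ 2 ≤ 2 * ‖a‖ ^ 2 + 2 * ‖b‖ ^ 2 := by
  have h := pow_le_pow_left₀ (norm_nonneg _) (norm_sub_le a b) 2
  nlinarith [sq_nonneg (‖a‖ - ‖b‖)]

theorem hs_sub_term_le (s : ℝ) (f g : L2) (k : ℤ) :
    (1 + (k : ℝ) ^ 2) ^ s * ‖fourierCoeff (f - g : L2) k‖ ^ 2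
      ≤ 2 * ((1 + (k : ℝ) ^ 2) ^ s * ‖fourierCoeff f k‖ ^ 2)
        + 2 * ((1 + (k : ℝ) ^ 2) ^ s * ‖fourierCoeff g k‖ ^ 2) := by
  rw [fourierCoeff_L2_sub]
  have h := norm_sub_sq_le_two_mul (fourierCoeff f k) (fourierCoeff g k)
  have h0 : (0 : ℝ) ≤ (1 + (k : ℝ) ^ 2) ^ s := by positivity
  nlinarith [mul_le_mul_of_nonneg_left h h0]

theorem MemHs.sub {s : ℝ} {f g : L2} (hf : MemHs s f) (hg : MemHs s g) : MemHs s (f - g) :=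
  ((hf.mul_left 2).add (hg.mul_left 2)).of_nonneg_of_le (fun k ↦ by positivity) (hs_sub_term_le s f g)

theorem hsNorm_sub_sq_le {s : ℝ} {f g : L2} (hf : MemHs s f) (hg : MemHs s g) :
    hsNorm s (f - g) ^ 2 ≤ 2 * hsNorm s f ^ 2 + 2 * hsNorm s g ^ 2 := by
  simp only [hsNorm_sq]
  exact hasSum_le (hs_sub_term_le s f g) (hf.sub hg).hasSum
    ((hf.hasSum.mul_left 2).add (hg.hasSum.mul_left 2))

theorem MemHs.trunc {s : ℝ} {f : L2} (hf : MemHs s f) (N : ℕ) : MemHs s (trunc f N) := by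
  refine hf.of_nonneg_of_le (fun k ↦ by positivity) fun k ↦ ?_
  rw [fourierCoeff_trunc]
  split_ifs
  · rfl
  · rw [norm_zero, zero_pow two_ne_zero, mul_zero]; positivity

theorem tendsto_hsNorm_sub_trunc {s : ℝ} {f : L2} (hf : IsHardy f) (hs : MemHs s f) :
    Tendsto (fun N ↦ hsNorm s (f - trunc f N)) atTop (𝓝 0) := by
  have h : Tendsto (fun N ↦ ∑' k : ℤ, (1 + (k : ℝ) ^ 2) ^ s
      * ‖fourierCoeff (f - trunc f N : L2) k‖ ^ 2) atTop (𝓝 (∑' _ : ℤ, 0)) := by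
    refine tendsto_tsum_of_dominated_convergence hs (fun k ↦ ?_) (Eventually.of_forall fun N k ↦ ?_)
    · refine tendsto_const_nhds.congr' ?_
      filter_upwards [eventually_gt_atTop k.toNat] with N hN
      rw [fourierCoeff_L2_sub, fourierCoeff_trunc]
      by_cases hk : 0 ≤ k
      · rw [if_pos (by omega)]; simp
      · rw [if_neg (by omega), hf k (by omega)]; simp
    · rw [Real.norm_of_nonneg (by positivity), fourierCoeff_L2_sub, fourierCoeff_trunc]
      gcongr
      split_ifs <;> simp
  have h' := h.sqrt
  rw [tsum_zero, Real.sqrt_zero] at h'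
  exact h'

/-- The cubic nonlinearity. -/
noncomputable def cubic (f : Torus → ℂ) (x : Torus) : ℂ := (‖f x‖ : ℂ) ^ 2 * f x

theorem norm_cubic (f : Torus → ℂ) (x : Torus) : ‖cubic f x‖ = ‖f x‖ ^ 3 := by
  rw [cubic, norm_mul, norm_pow, Complex.norm_real, norm_norm]; ring

theorem aestronglyMeasurable_cubic (f : L2) :
    AEStronglyMeasurable (cubic f) (haarAddCircle : Measure Torus) := by
  have h := Lp.aestronglyMeasurable f
  exact ((Complex.continuous_ofReal.comp_aestronglyMeasurable h.norm).pow 2).mul h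

/-- Young's inequality, by comparing `b` with `ε a`. A free `ε` allows one factor to be small in
`L⁴` while the other is merely bounded. -/
theorem cube_mul_le {a b ε : ℝ} (ha : 0 ≤ a) (hb : 0 ≤ b) (hε : 0 < ε) :
    a ^ 3 * b ≤ ε * a ^ 4 + ε⁻¹ ^ 3 * b ^ 4 := by
  rcases le_total b (ε * a) with h | h
  · have h1 : a ^ 3 * b ≤ a ^ 3 * (ε * a) := by gcongr
    have h2 : 0 ≤ ε⁻¹ ^ 3 * b ^ 4 := by positivity
    nlinarith
  · have h0 : a ≤ ε⁻¹ * b := by rwa [le_inv_mul_iff₀ hε]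
    have h1 : a ^ 3 * b ≤ (ε⁻¹ * b) ^ 3 * b := by gcongr
    have h2 : 0 ≤ ε * a ^ 4 := by positivity
    nlinarith

theorem integrable_cubic {f : L2} (hf : Integrable (fun x ↦ ‖f x‖ ^ 4) haarAddCircle) :
    Integrable (cubic f) haarAddCircle := by
  refine ((hf.const_mul 1).add (integrable_const 1)).mono' (aestronglyMeasurable_cubic f)
    (ae_of_all _ fun x ↦ ?_)
  have := cube_mul_le (norm_nonneg (f x)) zero_le_one one_pos
  simp only [Pi.add_apply, norm_cubic]
  norm_num at this ⊢
  exact this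

section pairing

variable {u v r : L2}

theorem norm_pairing_le {ε : ℝ} (hε : 0 < ε) (x : Torus) :
    ‖conj (r x) * (cubic u x - cubic v x)‖
      ≤ ε * (‖u x‖ ^ 4 + ‖v x‖ ^ 4) + 2 * ε⁻¹ ^ 3 * ‖r x‖ ^ 4 := by
  rw [norm_mul, RCLike.norm_conj]
  have h1 := norm_sub_le (cubic u x) (cubic v x)
  rw [norm_cubic, norm_cubic] at h1
  have h2 := mul_le_mul_of_nonneg_left h1 (norm_nonneg (r x))
  have h3 := cube_mul_le (norm_nonneg (u x)) (norm_nonneg (r x)) hε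
  have h4 := cube_mul_le (norm_nonneg (v x)) (norm_nonneg (r x)) hε
  linarith

variable (hu : Integrable (fun x ↦ ‖u x‖ ^ 4) haarAddCircle)
  (hv : Integrable (fun x ↦ ‖v x‖ ^ 4) haarAddCircle)
  (hr : Integrable (fun x ↦ ‖r x‖ ^ 4) haarAddCircle)

include hu hv hr

theorem integrable_pairing :
    Integrable (fun x ↦ conj (r x) * (cubic u x - cubic v x)) haarAddCircle :=
  (((hu.add hv).const_mul 1).add (hr.const_mul (2 * 1⁻¹ ^ 3))).mono'
    ((Complex.continuous_conj.comp_aestronglyMeasurable (Lp.aestronglyMeasurable r)).mul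
      ((aestronglyMeasurable_cubic u).sub (aestronglyMeasurable_cubic v)))
    (ae_of_all _ fun x ↦ norm_pairing_le one_pos x)

/-- A substitute for Hölder's inequality. With `ε = 1` it bounds the truncated pairings uniformly.
With `ε` small it proves their convergence when `r` tends to zero in `L⁴`. -/
theorem norm_integral_pairing_le {ε : ℝ} (hε : 0 < ε) :
    ‖∫ x, conj (r x) * (cubic u x - cubic v x) ∂haarAddCircle‖
      ≤ ε * (∫ x, ‖u x‖ ^ 4 ∂haarAddCircle + ∫ x, ‖v x‖ ^ 4 ∂haarAddCircle)
        + 2 * ε⁻¹ ^ 3 * ∫ x, ‖r x‖ ^ 4 ∂haarAddCircle := by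
  have h := norm_integral_le_of_norm_le
    (((hu.add hv).const_mul ε).add (hr.const_mul (2 * ε⁻¹ ^ 3)))
    (ae_of_all _ fun x ↦ norm_pairing_le (u := u) (v := v) (r := r) hε x)
  refine h.trans_eq ?_
  simp only [Pi.add_apply]
  rw [integral_add, integral_const_mul, integral_add hu hv, integral_const_mul]
  · exact (hu.add hv).const_mul ε
  · exact hr.const_mul _

end pairing

/-- Splitting off `|a|² |a - b|²`, which is real, leaves a factor `b` in every remaining term. Hence
only `b` has to be bounded in the uniqueness argument. -/
theorem abs_im_cubic_sub_le (a b : ℂ) :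
    |(conj (a - b) * ((‖a‖ : ℂ) ^ 2 * a - (‖b‖ : ℂ) ^ 2 * b)).im|
      ≤ 2 * ‖b‖ ^ 2 * ‖a - b‖ ^ 2 + ‖b‖ * ‖a - b‖ ^ 3 := by
  have h1 : conj (a - b) * ((‖a‖ : ℂ) ^ 2 * a - (‖b‖ : ℂ) ^ 2 * b)
      = ((‖a‖ ^ 2 - ‖b‖ ^ 2 : ℝ) : ℂ) * (conj (a - b) * b)
        + ((‖a‖ ^ 2 * ‖a - b‖ ^ 2 : ℝ) : ℂ) := by
    rw [Complex.ofReal_mul, ofReal_norm_sq (a - b)]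
    push_cast
    ring
  rw [h1, Complex.add_im, Complex.ofReal_im, add_zero, Complex.im_ofReal_mul, abs_mul]
  have h2 : |‖a‖ ^ 2 - ‖b‖ ^ 2| ≤ ‖a - b‖ * (2 * ‖b‖ + ‖a - b‖) := by
    rw [show ‖a‖ ^ 2 - ‖b‖ ^ 2 = (‖a‖ - ‖b‖) * (‖a‖ + ‖b‖) by ring, abs_mul,
      abs_of_nonneg (by positivity : 0 ≤ ‖a‖ + ‖b‖)]
    have := abs_norm_sub_norm_le a b
    have := norm_sub_norm_le a b
    exact mul_le_mul (by assumption) (by linarith) (by positivity) (norm_nonneg _)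
  have h3 : |(conj (a - b) * b).im| ≤ ‖a - b‖ * ‖b‖ := by
    refine (Complex.abs_im_le_norm _).trans_eq ?_
    rw [norm_mul, RCLike.norm_conj]
  calc _ ≤ ‖a - b‖ * (2 * ‖b‖ + ‖a - b‖) * (‖a - b‖ * ‖b‖) := by gcongr
    _ = _ := by ring

/-- The pairing controlling the growth of the `L²` distance between two solutions, one of them
bounded. -/
theorem abs_im_integral_pairing_le {u v : L2} (hu : IsHardy u) (hus : MemHs (1 / 2) u)
    (hv : IsHardy v) (hvs : MemHs (1 / 2) v) {V : ℝ} (hV : ∀ᵐ x ∂haarAddCircle, ‖v x‖ ≤ V) :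
    |(∫ x, conj ((u - v : L2) x) * (cubic u x - cubic v x) ∂haarAddCircle).im|
      ≤ (2 * V ^ 2 + V * (1 / 2 + 2 * hsNorm (1 / 2) (u - v) ^ 2)) * ‖u - v‖ ^ 2 := by
  have hw := integral_four_le (hu.sub hv) (hus.sub hvs)
  have hu4 := (integral_four_le hu hus).1
  have hv4 := (integral_four_le hv hvs).1
  have hV0 : 0 ≤ V := by
    obtain ⟨x, hx⟩ := hV.exists
    exact (norm_nonneg _).trans hx
  have h2 : Integrable (fun x ↦ ‖(u - v : L2) x‖ ^ 2) haarAddCircle := by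
    refine ((integrable_const 1).add hw.1).mono' ((Lp.aestronglyMeasurable _).norm.pow 2)
      (ae_of_all _ fun x ↦ ?_)
    rw [Real.norm_of_nonneg (by positivity), Pi.add_apply]
    nlinarith [sq_nonneg (‖(u - v : L2) x‖ ^ 2 - 1)]
  rw [← Complex.imCLM_apply, ← Complex.imCLM.integral_comp_comm (integrable_pairing hu4 hv4 hw.1),
    ← Real.norm_eq_abs]
  refine (norm_integral_le_of_norm_le
    ((h2.const_mul (2 * V ^ 2 + V / 2)).add (hw.1.const_mul (V / 2))) ?_).trans ?_
  · filter_upwards [hV, Lp.coeFn_sub u v] with x hx hsub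
    have h := abs_im_cubic_sub_le (u x) (v x)
    rw [← Pi.sub_apply, ← hsub] at h
    rw [Complex.imCLM_apply, Real.norm_eq_abs, cubic, cubic]
    refine h.trans ?_
    simp only [Pi.add_apply]
    set w := ‖(u - v : L2) x‖
    have hw0 : 0 ≤ w := norm_nonneg _
    have e1 : ‖v x‖ ^ 2 * w ^ 2 ≤ V ^ 2 * w ^ 2 := by gcongr
    have e2 : ‖v x‖ * w ^ 3 ≤ V * w ^ 3 := by gcongr
    -- The quartic part is again linear in `‖u - v‖²` by the Gagliardo–Nirenberg inequality, with
    -- the `H^{1/2}` norm in the coefficient.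
    have e3 : w ^ 3 ≤ w ^ 2 / 2 + w ^ 4 / 2 := by nlinarith [sq_nonneg (w ^ 2 - w)]
    nlinarith [mul_le_mul_of_nonneg_left e3 hV0]
  · simp only [Pi.add_apply]
    rw [integral_add (h2.const_mul _) (hw.1.const_mul _), integral_const_mul, integral_const_mul,
      ← L2_norm_sq]
    nlinarith [mul_le_mul_of_nonneg_left hw.2 hV0]

/-- A Grönwall lemma in integral form. -/
theorem eq_zero_of_le_integral {n : ℝ → ℝ} (hn : Continuous n) (hn0 : ∀ t, 0 ≤ n t) {L T : ℝ}
    (h : ∀ t ∈ Set.Icc 0 T, n t ≤ L * ∫ τ in (0 : ℝ)..t, n τ) : ∀ t ∈ Set.Icc 0 T, n t = 0 := by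
  have hY : ∀ t, HasDerivAt (fun t ↦ ∫ τ in (0 : ℝ)..t, n τ) (n t) t := fun t ↦
    (hn.integral_hasStrictDerivAt 0 t).hasDerivAt
  -- Grönwall is applied to the primitive of `n`, whose derivative `n` is at most `L` times the
  -- primitive itself.
  have hz := eq_zero_of_abs_deriv_le_mul_abs_self_of_eq_zero_right (K := L) (a := 0) (b := T)
    (fun t _ ↦ (hY t).continuousAt.continuousWithinAt)
    (fun t _ ↦ (hY t).hasDerivWithinAt) (by simp) (fun t ht ↦ by
      rw [Real.norm_of_nonneg (hn0 t), Real.norm_of_nonneg]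
      · exact h t (Set.Ico_subset_Icc_self ht)
      · exact intervalIntegral.integral_nonneg ht.1 fun τ _ ↦ hn0 τ)
  intro t ht
  have := h t ht
  rw [hz t ht, mul_zero] at this
  exact le_antisymm this (hn0 t)

namespace IsSolution

variable {α : ℝ} {u₀ : Torus → ℂ} {u v : ℝ → L2}

theorem integrable_four (hu : IsSolution α u₀ u) (t : ℝ) :
    Integrable (fun x ↦ ‖u t x‖ ^ 4) haarAddCircle :=
  (integral_four_le (hu.hardy t) (hu.memHs t)).1

theorem integral_four_le_hsNorm (hu : IsSolution α u₀ u) (t : ℝ) :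
    ∫ x, ‖u t x‖ ^ 4 ∂haarAddCircle ≤ 4 * hsNorm (1 / 2) (u t) ^ 4 := by
  refine (integral_four_le (hu.hardy t) (hu.memHs t)).2.trans ?_
  have := norm_le_hsNorm (by norm_num) (hu.memHs t)
  calc 4 * ‖u t‖ ^ 2 * hsNorm (1 / 2) (u t) ^ 2
      ≤ 4 * hsNorm (1 / 2) (u t) ^ 2 * hsNorm (1 / 2) (u t) ^ 2 := by gcongr
    _ = _ := by ring

theorem continuous_L2 (hu : IsSolution α u₀ u) : Continuous u := by
  refine continuous_iff_continuousAt.2 fun t ↦ ?_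
  rw [ContinuousAt, tendsto_iff_norm_sub_tendsto_zero]
  exact squeeze_zero (fun _ ↦ norm_nonneg _)
    (fun τ ↦ norm_le_hsNorm (by norm_num) ((hu.memHs τ).sub (hu.memHs t))) (hu.continuous t)

theorem exists_hsNorm_bound (hu : IsSolution α u₀ u) (T : ℝ) :
    ∃ B, ∀ t ∈ Set.Icc (-T) T, hsNorm (1 / 2) (u t) ≤ B := by
  refine isCompact_Icc.induction_on (p := fun s ↦ ∃ B, ∀ t ∈ s, hsNorm (1 / 2) (u t) ≤ B)
    ⟨0, by simp⟩ (fun s s' hss ⟨B, hB⟩ ↦ ⟨B, fun t ht ↦ hB t (hss ht)⟩) ?_ ?_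
  · rintro s s' ⟨B, hB⟩ ⟨B', hB'⟩
    refine ⟨max B B', fun t ht ↦ ?_⟩
    rcases ht with ht | ht
    · exact (hB t ht).trans (le_max_left _ _)
    · exact (hB' t ht).trans (le_max_right _ _)
  · intro t _
    refine ⟨{τ | hsNorm (1 / 2) (u τ - u t) < 1}, mem_nhdsWithin_of_mem_nhds
      ((hu.continuous t).eventually (gt_mem_nhds one_pos)),
      2 + 2 * hsNorm (1 / 2) (u t) ^ 2, fun τ hτ ↦ ?_⟩
    have hτ' : hsNorm (1 / 2) (u τ - u t) < 1 := hτ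
    have hm : MemHs (1 / 2) (u t - u τ) := (hu.memHs t).sub (hu.memHs τ)
    have h1 := hsNorm_sub_sq_le (hu.memHs t) hm
    have h2 : hsNorm (1 / 2) (u t - u τ) = hsNorm (1 / 2) (u τ - u t) := by
      simp only [hsNorm, fourierCoeff_L2_sub]
      simp only [norm_sub_rev]
    rw [sub_sub_cancel, h2] at h1
    have h3 := hsNorm_nonneg (1 / 2) (u τ - u t)
    nlinarith [sq_nonneg (hsNorm (1 / 2) (u τ) - 1)]

/-- The equation is only known coefficient by coefficient, so the mass of the difference is
differentiated on finitely many modes. By orthogonality the result is the pairing with the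
truncation. -/
theorem hasDerivAt_trunc (hu : IsSolution α u₀ u) (hv : IsSolution α u₀ v) (N : ℕ) (t : ℝ) :
    HasDerivAt (fun τ ↦ ∑ k ∈ Finset.range N, ‖fourierCoeff (u τ - v τ : L2) k‖ ^ 2)
      (2 * (∫ x, conj (trunc (u t - v t) N x) * (cubic (u t) x - cubic (v t) x)
        ∂haarAddCircle).im) t := by
  set w : L2 := u t - v t with hw
  have hcu := integrable_cubic (hu.integrable_four t)
  have hcv := integrable_cubic (hv.integrable_four t)
  set F : Torus → ℂ := fun x ↦ cubic (u t) x - cubic (v t) x with hF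
  have hFi : Integrable F haarAddCircle := hcu.sub hcv
  have hpair : ∫ x, conj (trunc w N x) * F x ∂haarAddCircle
      = ∑ k ∈ Finset.range N, conj (fourierCoeff w k) * fourierCoeff F k := by
    have h1 : ∀ k : ℕ, conj (fourierCoeff w k) * fourierCoeff F k
        = ∫ x, conj (fourierCoeff w k) * (conj (fourier (k : ℤ) x) * F x) ∂haarAddCircle := fun k ↦ by
      rw [fourierCoeff_eq_integral F, integral_const_mul]
    simp only [h1]
    rw [← integral_finsetSum]
    · refine integral_congr_ae ?_
      filter_upwards [coeFn_trunc w N] with x hx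
      rw [hx, map_sum, Finset.sum_mul]
      simp only [map_mul, mul_assoc]
    · intro k _
      refine Integrable.const_mul ?_ _
      simpa only [fourier_neg, smul_eq_mul] using hFi.fourier_smul (-(k : ℤ))
  have hder : ∀ k : ℕ, HasDerivAt (fun τ ↦ ‖fourierCoeff (u τ - v τ : L2) k‖ ^ 2)
      (2 * (conj (fourierCoeff w k) * fourierCoeff F k).im) t := by
    intro k
    simp only [fourierCoeff_L2_sub]
    have h := ((hu.equation k t).sub (hv.equation k t)).norm_sq
    convert! h using 1
    have e1 : fourierCoeff F k = fourierCoeff (cubic (u t)) k - fourierCoeff (cubic (v t)) k := by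
      simp only [fourierCoeff_eq_integral, hF, mul_sub]
      refine integral_sub ?_ ?_
      · simpa only [fourier_neg, smul_eq_mul] using hcu.fourier_smul (-(k : ℤ))
      · simpa only [fourier_neg, smul_eq_mul] using hcv.fourier_smul (-(k : ℤ))
    have e2 : ∀ f : L2, mean f = fourierCoeff f 0 := fun f ↦ integral_eq_fourierCoeff_zero f
    have e3 : ∀ f : L2, szegoCoeff (fun x ↦ (‖f x‖ : ℂ) ^ 2 * f x) k = fourierCoeff (cubic f) k :=
      fun f ↦ if_pos (by positivity)
    rw [e3, e3, e2, e2, fourierCoeff_const, fourierCoeff_const, Pi.sub_apply, Complex.inner, e1, hw,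
      fourierCoeff_L2_sub]
    congr 1
    -- Mode zero is the only one that sees `α`. Its contribution `-i α |a - b|²` has no real part.
    rcases k with _ | k
    · simp only [Nat.cast_zero, if_true]
      set a := fourierCoeff (u t) 0
      set b := fourierCoeff (v t) 0
      have : conj (a - b) * (-Complex.I * (fourierCoeff (cubic (u t)) 0 + α * a)
            - -Complex.I * (fourierCoeff (cubic (v t)) 0 + α * b))
          = -(Complex.I * (conj (a - b) * (fourierCoeff (cubic (u t)) 0
              - fourierCoeff (cubic (v t)) 0)))
            - Complex.I * ((α * ‖a - b‖ ^ 2 : ℝ) : ℂ) := by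
        rw [Complex.ofReal_mul, ofReal_norm_sq]
        ring
      rw [mul_comm _ (conj (a - b)), this, Complex.sub_re, Complex.neg_re, Complex.I_mul_re, Complex.I_mul_re,
        Complex.ofReal_im]
      ring
    · rw [if_neg (by omega), if_neg (by omega)]
      set a := fourierCoeff (cubic (u t)) ((k + 1 : ℕ) : ℤ)
      set b := fourierCoeff (cubic (v t)) ((k + 1 : ℕ) : ℤ)
      set z := conj (fourierCoeff (u t) ((k + 1 : ℕ) : ℤ) - fourierCoeff (v t) ((k + 1 : ℕ) : ℤ))
      have : z * (-Complex.I * (a + α * 0) - -Complex.I * (b + α * 0))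
          = -(Complex.I * (z * (a - b))) := by ring
      rw [mul_comm _ z, this, Complex.neg_re, Complex.I_mul_re, neg_neg]
  rw [hpair, Complex.im_sum, Finset.mul_sum]
  exact HasDerivAt.fun_sum fun k _ ↦ hder k

/-- The integrated energy identity for the difference of two solutions. -/
theorem norm_sub_sq_eq_integral (hu : IsSolution α u₀ u) (hv : IsSolution α u₀ v) {a b T : ℝ}
    (ha : a ∈ Set.Icc (-T) T) (hb : b ∈ Set.Icc (-T) T) :
    ‖u b - v b‖ ^ 2 - ‖u a - v a‖ ^ 2 = ∫ t in a..b,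
      2 * (∫ x, conj ((u t - v t : L2) x) * (cubic (u t) x - cubic (v t) x) ∂haarAddCircle).im := by
  have hwH : ∀ t, IsHardy (u t - v t) := fun t ↦ (hu.hardy t).sub (hv.hardy t)
  have hwS : ∀ t, MemHs (1 / 2) (u t - v t) := fun t ↦ (hu.memHs t).sub (hv.memHs t)
  obtain ⟨B, hB⟩ := hu.exists_hsNorm_bound T
  obtain ⟨B', hB'⟩ := hv.exists_hsNorm_bound T
  set y : ℕ → ℝ → ℝ := fun N t ↦ ∑ k ∈ Finset.range N, ‖fourierCoeff (u t - v t : L2) k‖ ^ 2 with hy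
  set g : ℕ → ℝ → ℝ := fun N t ↦ 2 * (∫ x, conj (trunc (u t - v t) N x)
    * (cubic (u t) x - cubic (v t) x) ∂haarAddCircle).im with hg
  have hyg : ∀ N t, HasDerivAt (y N) (g N t) t := fun N t ↦ hu.hasDerivAt_trunc hv N t
  -- Measurability in time comes for free because `g N` is a derivative.
  have hgm : ∀ N, Measurable (g N) := fun N ↦ by
    have : g N = deriv (y N) := funext fun t ↦ (hyg N t).deriv.symm
    rw [this]
    exact measurable_deriv _
  have hsub : Set.uIcc a b ⊆ Set.Icc (-T) T := Set.uIcc_subset_Icc ha hb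
  set C : ℝ := 2 * (1 * (4 * B ^ 4 + 4 * B' ^ 4)
    + 2 * 1⁻¹ ^ 3 * (4 * (2 * B ^ 2 + 2 * B' ^ 2) * (2 * B ^ 2 + 2 * B' ^ 2))) with hC
  have hgC : ∀ N, ∀ t ∈ Set.Icc (-T) T, ‖g N t‖ ≤ C := by
    intro N t ht
    have h1 := norm_integral_pairing_le (hu.integrable_four t) (hv.integrable_four t)
      (integrable_trunc_four (u t - v t) N) one_pos
    have h2 := (hu.integral_four_le_hsNorm t).trans (mul_le_mul_of_nonneg_left
      (pow_le_pow_left₀ (hsNorm_nonneg _ _) (hB t ht) 4) (by norm_num))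
    have h3 := (hv.integral_four_le_hsNorm t).trans (mul_le_mul_of_nonneg_left
      (pow_le_pow_left₀ (hsNorm_nonneg _ _) (hB' t ht) 4) (by norm_num))
    have h4 : hsNorm (1 / 2) (u t - v t) ^ 2 ≤ 2 * B ^ 2 + 2 * B' ^ 2 := by
      refine (hsNorm_sub_sq_le (hu.memHs t) (hv.memHs t)).trans ?_
      have := pow_le_pow_left₀ (hsNorm_nonneg _ _) (hB t ht) 2
      have := pow_le_pow_left₀ (hsNorm_nonneg _ _) (hB' t ht) 2
      linarith
    have h5 : ‖u t - v t‖ ^ 2 ≤ 2 * B ^ 2 + 2 * B' ^ 2 :=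
      (pow_le_pow_left₀ (norm_nonneg _) (norm_le_hsNorm (by norm_num) (hwS t)) 2).trans h4
    have h6 : ∫ x, ‖trunc (u t - v t) N x‖ ^ 4 ∂haarAddCircle
        ≤ 4 * (2 * B ^ 2 + 2 * B' ^ 2) * (2 * B ^ 2 + 2 * B' ^ 2) := by
      refine (integral_trunc_four_le (hwH t) (hwS t) N).trans ?_
      gcongr
    rw [hg, Real.norm_eq_abs, abs_mul, abs_two, hC]
    refine mul_le_mul_of_nonneg_left ((Complex.abs_im_le_norm _).trans (h1.trans ?_)) two_pos.le
    gcongr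
  have hgi : ∀ N, IntervalIntegrable (g N) volume a b := by
    intro N
    refine (intervalIntegrable_const (c := C)).mono_fun (hgm N).aestronglyMeasurable ?_
    filter_upwards [ae_restrict_mem measurableSet_uIoc] with t ht
    exact (hgC N t (hsub (Set.uIoc_subset_uIcc ht))).trans (le_abs_self C)
  have hFTC : ∀ N, ∫ t in a..b, g N t = y N b - y N a := fun N ↦
    intervalIntegral.integral_eq_sub_of_hasDerivAt (fun t _ ↦ hyg N t) (hgi N)
  have hylim : ∀ t, Tendsto (fun N ↦ y N t) atTop (𝓝 (‖u t - v t‖ ^ 2)) := by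
    intro t
    have h := hasSum_sq_fourierCoeff_norm (u t - v t)
    rw [hasSum_nat_of_int (fun k hk ↦ by rw [hwH t k hk]; simp)] at h
    exact h.tendsto_sum_nat
  have hglim : ∀ t, Tendsto (fun N ↦ g N t) atTop (𝓝 (2 * (∫ x, conj ((u t - v t : L2) x)
      * (cubic (u t) x - cubic (v t) x) ∂haarAddCircle).im)) := by
    intro t
    set w : L2 := u t - v t with hw
    have hint : Tendsto (fun N ↦ ∫ x, conj (trunc w N x) * (cubic (u t) x - cubic (v t) x)
        ∂haarAddCircle) atTop (𝓝 (∫ x, conj (w x) * (cubic (u t) x - cubic (v t) x)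
        ∂haarAddCircle)) := by
      set D := ∫ x, ‖u t x‖ ^ 4 ∂haarAddCircle + ∫ x, ‖v t x‖ ^ 4 ∂haarAddCircle with hD
      have hD0 : 0 ≤ D := by
        have h1 : 0 ≤ ∫ x, ‖u t x‖ ^ 4 ∂haarAddCircle := integral_nonneg fun x ↦ by positivity
        have h2 : 0 ≤ ∫ x, ‖v t x‖ ^ 4 ∂haarAddCircle := integral_nonneg fun x ↦ by positivity
        linarith
      set R : ℕ → ℝ := fun N ↦ ∫ x, ‖(w - trunc w N : L2) x‖ ^ 4 ∂haarAddCircle with hR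
      have hRH : ∀ N, IsHardy (w - trunc w N) := fun N ↦ (hwH t).sub (IsHardy.trunc w N)
      have hRS : ∀ N, MemHs (1 / 2) (w - trunc w N) := fun N ↦ (hwS t).sub ((hwS t).trunc N)
      have hRlim : Tendsto R atTop (𝓝 0) := by
        have h1 := tendsto_hsNorm_sub_trunc (hwH t) (hwS t)
        have h2 : Tendsto (fun N ↦ 4 * hsNorm (1 / 2) (w - trunc w N) ^ 2
            * hsNorm (1 / 2) (w - trunc w N) ^ 2) atTop (𝓝 0) := by
          simpa using ((h1.pow 2).const_mul 4).mul (h1.pow 2)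
        refine squeeze_zero (fun N ↦ integral_nonneg fun x ↦ by positivity) (fun N ↦ ?_) h2
        refine (integral_four_le (hRH N) (hRS N)).2.trans ?_
        have := norm_le_hsNorm (by norm_num) (hRS N)
        gcongr
      have hdiff : ∀ N, ∀ ε > 0, ‖(∫ x, conj (trunc w N x) * (cubic (u t) x - cubic (v t) x)
          ∂haarAddCircle) - ∫ x, conj (w x) * (cubic (u t) x - cubic (v t) x) ∂haarAddCircle‖
          ≤ ε * D + 2 * ε⁻¹ ^ 3 * R N := by
        intro N ε hε
        rw [norm_sub_rev, ← integral_sub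
          (integrable_pairing (hu.integrable_four t) (hv.integrable_four t)
            (integral_four_le (hwH t) (hwS t)).1)
          (integrable_pairing (hu.integrable_four t) (hv.integrable_four t)
            (integrable_trunc_four w N))]
        have h1 := norm_integral_pairing_le (hu.integrable_four t) (hv.integrable_four t)
          (integral_four_le (hRH N) (hRS N)).1 hε
        refine le_trans (le_of_eq ?_) h1
        congr 1
        refine integral_congr_ae ?_
        filter_upwards [Lp.coeFn_sub w (trunc w N)] with x hx
        rw [hx, Pi.sub_apply, map_sub]
        ring
      rw [tendsto_iff_norm_sub_tendsto_zero, Metric.tendsto_atTop]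
      intro η hη
      -- This makes the bounded quartic part less than `η / 2`. For this fixed `ε`, the remainder
      -- tends to zero with `N`.
      set ε := η / (2 * (D + 1)) with hε
      have hε0 : 0 < ε := by positivity
      have hεD : ε * D < η / 2 := by
        rw [hε, div_mul_eq_mul_div, div_lt_div_iff₀ (by positivity) two_pos]
        nlinarith
      have h2 : ∀ᶠ N in atTop, 2 * ε⁻¹ ^ 3 * R N < η / 2 := by
        have : Tendsto (fun N ↦ 2 * ε⁻¹ ^ 3 * R N) atTop (𝓝 0) := by
          have h := hRlim.const_mul (2 * ε⁻¹ ^ 3)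
          rwa [mul_zero] at h
        exact this.eventually (gt_mem_nhds (by positivity))
      obtain ⟨N₀, hN₀⟩ := eventually_atTop.1 h2
      refine ⟨N₀, fun N hN ↦ ?_⟩
      rw [Real.dist_0_eq_abs, abs_of_nonneg (norm_nonneg _)]
      linarith [hdiff N ε hε0, hN₀ N hN]
    exact ((Complex.continuous_im.tendsto _).comp hint).const_mul 2
  have hlim1 := intervalIntegral.tendsto_integral_filter_of_dominated_convergence
    (μ := volume) (a := a) (b := b) (F := g) (l := atTop) (fun _ ↦ C)
    (Eventually.of_forall fun N ↦ (hgm N).aestronglyMeasurable)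
    (Eventually.of_forall fun N ↦ ae_of_all _ fun t ht ↦
      hgC N t (hsub (Set.uIoc_subset_uIcc ht)))
    intervalIntegrable_const (ae_of_all _ fun t _ ↦ hglim t)
  simp only [hFTC] at hlim1
  exact tendsto_nhds_unique ((hylim b).sub (hylim a)) hlim1

/-- Two solutions with the same initial data coincide if one of them is locally bounded. -/
theorem eq_of_bounded (hu : IsSolution α u₀ u) (hv : IsSolution α u₀ v)
    (hV : ∀ T, ∃ V, ∀ t ∈ Set.Icc (-T) T, ∀ᵐ x ∂haarAddCircle, ‖v t x‖ ≤ V) : u = v := by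
  have hn : Continuous fun t ↦ ‖u t - v t‖ ^ 2 := (hu.continuous_L2.sub hv.continuous_L2).norm.pow 2
  have hn0 : ‖u 0 - v 0‖ ^ 2 = 0 := by
    have : u 0 = v 0 := Lp.ext (hu.initial.trans hv.initial.symm)
    rw [this, sub_self, norm_zero]; norm_num
  have key : ∀ T : ℝ, 0 ≤ T → ∀ t ∈ Set.Icc (-T) T, ‖u t - v t‖ ^ 2 = 0 := by
    intro T hT
    obtain ⟨V, hV⟩ := hV T
    obtain ⟨B, hB⟩ := hu.exists_hsNorm_bound T
    obtain ⟨B', hB'⟩ := hv.exists_hsNorm_bound T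
    have hT0 : (0 : ℝ) ∈ Set.Icc (-T) T := ⟨by linarith, hT⟩
    have hV0 : 0 ≤ V := by
      obtain ⟨x, hx⟩ := (hV 0 hT0).exists
      exact (norm_nonneg _).trans hx
    set L := 2 * (2 * V ^ 2 + V * (1 / 2 + 2 * (2 * B ^ 2 + 2 * B' ^ 2))) with hL
    have hbound : ∀ t ∈ Set.Icc (-T) T, ‖2 * (∫ x, conj ((u t - v t : L2) x)
        * (cubic (u t) x - cubic (v t) x) ∂haarAddCircle).im‖ ≤ L * ‖u t - v t‖ ^ 2 := by
      intro t ht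
      have h1 := abs_im_integral_pairing_le (hu.hardy t) (hu.memHs t) (hv.hardy t) (hv.memHs t)
        (hV t ht)
      have h4 : hsNorm (1 / 2) (u t - v t) ^ 2 ≤ 2 * B ^ 2 + 2 * B' ^ 2 := by
        refine (hsNorm_sub_sq_le (hu.memHs t) (hv.memHs t)).trans ?_
        have := pow_le_pow_left₀ (hsNorm_nonneg _ _) (hB t ht) 2
        have := pow_le_pow_left₀ (hsNorm_nonneg _ _) (hB' t ht) 2
        linarith
      rw [Real.norm_eq_abs, abs_mul, abs_two, hL, mul_assoc 2]
      refine mul_le_mul_of_nonneg_left (h1.trans ?_) two_pos.le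
      gcongr
    have hdist : ∀ a ∈ Set.Icc (-T) T, ∀ b ∈ Set.Icc (-T) T, a ≤ b →
        |‖u b - v b‖ ^ 2 - ‖u a - v a‖ ^ 2| ≤ L * ∫ t in a..b, ‖u t - v t‖ ^ 2 := by
      intro a ha b hb hab
      rw [hu.norm_sub_sq_eq_integral hv ha hb, ← intervalIntegral.integral_const_mul,
        ← Real.norm_eq_abs]
      refine intervalIntegral.norm_integral_le_of_norm_le hab (ae_of_all _ fun t ht ↦
        hbound t ⟨ha.1.trans ht.1.le, ht.2.trans hb.2⟩) ?_
      exact (hn.const_mul L).intervalIntegrable _ _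
    have hfwd := eq_zero_of_le_integral hn (fun t ↦ sq_nonneg _) (L := L) (T := T) (fun t ht ↦ by
      have h := hdist 0 hT0 t ⟨by linarith [ht.1], ht.2⟩ ht.1
      rw [hn0, sub_zero, abs_of_nonneg (sq_nonneg _)] at h
      exact h)
    -- Negative times follow from the same two-sided estimate after the reflection `t ↦ -t`.
    have hbwd := eq_zero_of_le_integral (n := fun t ↦ ‖u (-t) - v (-t)‖ ^ 2)
      (hn.comp continuous_neg) (fun t ↦ sq_nonneg _) (L := L) (T := T) (fun t ht ↦ by
      have h := hdist (-t) ⟨by linarith [ht.2], by linarith [ht.1]⟩ 0 hT0 (by linarith [ht.1])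
      rw [hn0, zero_sub, abs_neg, abs_of_nonneg (sq_nonneg _)] at h
      have e := intervalIntegral.integral_comp_neg (a := 0) (b := t)
        (fun t ↦ ‖u t - v t‖ ^ 2)
      rw [neg_zero] at e
      rw [e]
      exact h)
    intro t ht
    rcases le_total 0 t with h | h
    · exact hfwd t ⟨h, ht.2⟩
    · simpa using hbwd (-t) ⟨by linarith, by linarith [ht.1]⟩
  ext1 t
  have := key |t| (abs_nonneg t) t ⟨neg_abs_le t, le_abs_self t⟩
  rwa [sq_eq_zero_iff, norm_eq_zero, sub_eq_zero] at this

end IsSolution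

/-! ### Growth of Sobolev norms -/

theorem norm_rationalData_le (b c : ℂ) {p : ℂ} (hp : ‖p‖ < 1) (x : Torus) :
    ‖rationalData b c p x‖ ≤ ‖b‖ + ‖c‖ / (1 - ‖p‖) := by
  have h : 1 - ‖p‖ ≤ ‖1 - p * fourier 1 x‖ := by
    have := norm_sub_norm_le 1 (p * fourier 1 x)
    rwa [norm_one, norm_mul, norm_fourier_apply, mul_one] at this
  rw [rationalData]
  refine (norm_add_le _ _).trans ?_
  rw [norm_div, norm_mul, norm_fourier_apply, mul_one]
  have : 0 < 1 - ‖p‖ := by linarith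
  gcongr

/-- The exponential rate of growth of the `H^s` norm at the critical energy. -/
noncomputable def growthRate (α s Q M : ℝ) : ℝ := (s - 1 / 2) * Real.sqrt (IsReduced.rateSq α Q M)

namespace IsReduced

variable {α : ℝ} {b m p : ℝ → ℂ}

/-- Since `p` is continuous with `|p| < 1`, the explicit solution is bounded uniformly on compact
time intervals. It serves as the bounded competitor in `eq_of_bounded`. -/
theorem eq_sol (h : IsReduced α b m p) {u₀ : Torus → ℂ}
    (h0 : u₀ = rationalData (b 0) (m 0 * (1 - p 0 * conj (p 0))) (p 0)) {u : ℝ → L2}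
    (hu : IsSolution α u₀ u) : u = h.sol := by
  refine hu.eq_of_bounded (h.isSolution h0) fun T ↦ ?_
  have hc : Continuous fun t ↦ ‖b t‖ + ‖m t * (1 - p t * conj (p t))‖ / (1 - ‖p t‖) :=
    h.continuous_b.norm.add (h.continuous_c.norm.div (continuous_const.sub h.continuous_p.norm)
      fun t ↦ (sub_pos.2 (h.p_lt t)).ne')
  obtain ⟨V, hV⟩ := (isCompact_Icc (a := -T) (b := T)).exists_bound_of_continuousOn hc.continuousOn
  refine ⟨V, fun t ht ↦ ?_⟩
  filter_upwards [coeFn_rationalLp (b t) (m t * (1 - p t * conj (p t))) (h.p_lt t)] with x hx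
  rw [sol, hx]
  exact (norm_rationalData_le _ _ (h.p_lt t) x).trans ((le_abs_self _).trans (hV t ht))

theorem memHs_sol (h : IsReduced α b m p) {s : ℝ} (hs : 0 ≤ s) (t : ℝ) : MemHs s (h.sol t) :=
  memHs_rationalLp _ _ _ hs

theorem one_le_inv_delta (h : IsReduced α b m p) (t : ℝ) : 1 ≤ (1 - ‖p t‖ ^ 2)⁻¹ :=
  (one_le_inv₀ (h.delta_pos t)).2 (by linarith [sq_nonneg ‖p t‖])

theorem hsNorm_sol_sq (h : IsReduced α b m p) {s : ℝ} (hs : 0 ≤ s) (t : ℝ) :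
    hsNorm s (h.sol t) ^ 2
      = ‖b t‖ ^ 2 + ‖m 0‖ ^ 2 * (1 - ‖p t‖ ^ 2) ^ 2 * weightedGeom s (‖p t‖ ^ 2) := by
  rw [hsNorm_sq, sol, (hasSum_hs_rationalLp _ _ (h.p_lt t) hs).tsum_eq, norm_mul, mul_pow,
    h.orbit.norm_m_eq t, ← ofReal_delta, Complex.norm_real, Real.norm_of_nonneg (h.delta_pos t).le]

theorem sq_mul_inv_rpow {d : ℝ} (hd : 0 < d) (s : ℝ) :
    d ^ 2 * d⁻¹ ^ (2 * s + 1) = d⁻¹ ^ (2 * s - 1) := by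
  rw [show 2 * s + 1 = (2 * s - 1) + 2 by ring, Real.rpow_add (by positivity), Real.rpow_two]
  field_simp

/-- The `H^s` norm of the solution is comparable to a power of `1 - |p|²`. -/
theorem exists_hsNorm_sol_bounds (h : IsReduced α b m p) {s : ℝ} (hs : 0 ≤ s) :
    ∃ A₁ > 0, ∃ A₂ > 0, ∃ B ≥ 0, ∀ t,
      A₁ * ((1 - ‖p t‖ ^ 2)⁻¹) ^ (2 * s - 1) ≤ hsNorm s (h.sol t) ^ 2 ∧
      hsNorm s (h.sol t) ^ 2 ≤ B + A₂ * ((1 - ‖p t‖ ^ 2)⁻¹) ^ (2 * s - 1) := by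
  obtain ⟨A₁, hA₁, h1⟩ := le_weightedGeom hs
  obtain ⟨A₂, hA₂, h2⟩ := weightedGeom_le hs
  have hM : 0 < ‖m 0‖ ^ 2 := by have := norm_pos_iff.2 h.m_ne; positivity
  -- The additive constant is the conserved mass, which bounds `|b|²`.
  refine ⟨‖m 0‖ ^ 2 * A₁, by positivity, ‖m 0‖ ^ 2 * A₂, by positivity,
    ‖b 0‖ ^ 2 + ‖m 0‖ ^ 2 * (1 - ‖p 0‖ ^ 2),
    add_nonneg (sq_nonneg _) (mul_nonneg hM.le (h.delta_pos 0).le), fun t ↦ ?_⟩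
  have hd := h.delta_pos t
  have hr : ‖p t‖ ^ 2 < 1 := by linarith
  have hc : 0 ≤ ‖m 0‖ ^ 2 * (1 - ‖p t‖ ^ 2) ^ 2 := by positivity
  rw [h.hsNorm_sol_sq hs, ← sq_mul_inv_rpow hd]
  constructor
  · have := mul_le_mul_of_nonneg_left (h1 _ (sq_nonneg _) hr) hc
    nlinarith [sq_nonneg ‖b t‖]
  · have e1 := mul_le_mul_of_nonneg_left (h2 _ (sq_nonneg _) hr) hc
    have e2 := h.orbit.mass_eq t
    have e3 := mul_nonneg (sq_nonneg ‖m t‖) hd.le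
    nlinarith

theorem exists_hsNorm_sol_le (h : IsReduced α b m p)
    (hK : ‖b 0 + m 0 * conj (p 0)‖ ^ 2 ≠ α) {s : ℝ} (hs : 0 ≤ s) :
    ∃ C, ∀ t, hsNorm s (h.sol t) ≤ C := by
  obtain ⟨d, hd, hδ⟩ := h.exists_delta_lower_bound hK
  obtain ⟨A₁, -, A₂, hA₂, B, hB, hbd⟩ := h.exists_hsNorm_sol_bounds hs
  -- The exponent `2s - 1` may be negative. As `1 / δ ≥ 1`, it can be raised to `2s + 1 > 0`, for
  -- which the power is monotone.
  refine ⟨Real.sqrt (B + A₂ * d⁻¹ ^ (2 * s + 1)), fun t ↦ Real.le_sqrt_of_sq_le ?_⟩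
  refine (hbd t).2.trans ?_
  have h1 := h.one_le_inv_delta t
  have h2 : (1 - ‖p t‖ ^ 2)⁻¹ ≤ d⁻¹ := inv_anti₀ hd (hδ t)
  gcongr
  calc ((1 - ‖p t‖ ^ 2)⁻¹) ^ (2 * s - 1)
      ≤ ((1 - ‖p t‖ ^ 2)⁻¹) ^ (2 * s + 1) := Real.rpow_le_rpow_of_exponent_le h1 (by linarith)
    _ ≤ d⁻¹ ^ (2 * s + 1) := Real.rpow_le_rpow (by linarith) h2 (by linarith)

/-- The squared norm is comparable to `(1 / δ)^{2s - 1}`: the additive constant is absorbed because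
`1 / δ ≥ 1` and `s > 1/2`. Since `1 / δ ≈ e^{κ |t|}`, taking a square root gives the rate `(s - 1/2)
κ`. -/
theorem growsLikeExp (h : IsReduced α b m p) (hα : 0 < α) {Q M : ℝ}
    (hQ : Q = ‖b 0‖ ^ 2 + ‖m 0‖ ^ 2 * (1 - ‖p 0‖ ^ 2)) (hM : M = ‖m 0‖ ^ 2)
    (hK : ‖b 0 + m 0 * conj (p 0)‖ ^ 2 = α) {s : ℝ} (hs : 1 / 2 < s) :
    0 < growthRate α s Q M ∧ GrowsLikeExp s (growthRate α s Q M) h.sol := by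
  obtain ⟨hκ, D₁, hD₁, D₂, hD₂, hD⟩ := h.delta_exponential hα hQ hM hK
  obtain ⟨A₁, hA₁, A₂, hA₂, B, hB, hbd⟩ := h.exists_hsNorm_sol_bounds (s := s) (by linarith)
  have hσ : 0 ≤ 2 * s - 1 := by linarith
  have hE : ∀ t : ℝ, Real.exp (growthRate α s Q M * |t|) ^ 2
      = Real.exp (Real.sqrt (rateSq α Q M) * |t|) ^ (2 * s - 1) := fun t ↦ by
    rw [← Real.exp_mul, ← Real.exp_nat_mul, growthRate]
    congr 1
    push_cast
    ring
  refine ⟨mul_pos (by linarith) (Real.sqrt_pos.2 hκ), ?_, ?_⟩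
  · refine IsBigO.of_bound (Real.sqrt ((B + A₂) * D₂ ^ (2 * s - 1))) (Eventually.of_forall fun t ↦ ?_)
    rw [Real.norm_of_nonneg (hsNorm_nonneg _ _), Real.norm_of_nonneg (Real.exp_pos _).le]
    refine le_of_sq_le_sq ?_ (by positivity)
    rw [mul_pow, Real.sq_sqrt (by positivity), hE]
    set y := (1 - ‖p t‖ ^ 2)⁻¹
    have h1 : 1 ≤ y ^ (2 * s - 1) := Real.one_le_rpow (h.one_le_inv_delta t) hσ
    have hy0 : 0 ≤ y := by linarith [h.one_le_inv_delta t]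
    have h2 : y ^ (2 * s - 1) ≤ D₂ ^ (2 * s - 1)
        * Real.exp (Real.sqrt (rateSq α Q M) * |t|) ^ (2 * s - 1) := by
      rw [← Real.mul_rpow hD₂.le (Real.exp_pos _).le]
      exact Real.rpow_le_rpow hy0 (hD t).2 hσ
    calc hsNorm s (h.sol t) ^ 2 ≤ B + A₂ * y ^ (2 * s - 1) := (hbd t).2
      _ ≤ (B + A₂) * y ^ (2 * s - 1) := by nlinarith
      _ ≤ (B + A₂) * (D₂ ^ (2 * s - 1)
          * Real.exp (Real.sqrt (rateSq α Q M) * |t|) ^ (2 * s - 1)) := by gcongr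
      _ = _ := by ring
  · set c := A₁ * D₁ ^ (2 * s - 1) with hc
    have hc0 : 0 < c := by positivity
    refine IsBigO.of_bound (Real.sqrt c⁻¹) (Eventually.of_forall fun t ↦ ?_)
    rw [Real.norm_of_nonneg (hsNorm_nonneg _ _), Real.norm_of_nonneg (Real.exp_pos _).le]
    refine le_of_sq_le_sq ?_ (mul_nonneg (Real.sqrt_nonneg _) (hsNorm_nonneg _ _))
    rw [mul_pow, Real.sq_sqrt (by positivity), hE, ← div_eq_inv_mul, le_div_iff₀ hc0]
    refine le_trans ?_ (hbd t).1
    have h2 : D₁ ^ (2 * s - 1) * Real.exp (Real.sqrt (rateSq α Q M) * |t|) ^ (2 * s - 1)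
        ≤ ((1 - ‖p t‖ ^ 2)⁻¹) ^ (2 * s - 1) := by
      rw [← Real.mul_rpow hD₁.le (Real.exp_pos _).le]
      exact Real.rpow_le_rpow (by positivity) (hD t).1 hσ
    rw [hc]
    nlinarith [mul_le_mul_of_nonneg_left h2 hA₁.le]

end IsReduced

theorem not_growsLikeExp_of_bounded {s C B : ℝ} {u : ℝ → L2} (hC : 0 < C)
    (hB : ∀ t, hsNorm s (u t) ≤ B) : ¬ GrowsLikeExp s C u := by
  intro h
  obtain ⟨A, hA⟩ := h.2.bound
  have h1 : Tendsto (fun t : ℝ ↦ Real.exp (C * |t|)) (cocompact ℝ) atTop :=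
    Real.tendsto_exp_atTop.comp ((tendsto_norm_cocompact_atTop (E := ℝ)).const_mul_atTop hC)
  obtain ⟨t, h2, h3⟩ := (hA.and (h1.eventually_gt_atTop (|A| * |B|))).exists
  rw [Real.norm_of_nonneg (Real.exp_pos _).le, Real.norm_of_nonneg (hsNorm_nonneg _ _)] at h2
  have h4 : A * hsNorm s (u t) ≤ |A| * |B| :=
    mul_le_mul (le_abs_self _) ((hB t).trans (le_abs_self _)) (hsNorm_nonneg _ _) (abs_nonneg _)
  linarith

end AlphaSzego

/-! ### The main theorem. -/

open AlphaSzego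

theorem mainTheorem1 :
    ∃ rate : ℝ → ℝ → ℝ → ℝ → ℝ,
      ∀ (α : ℝ) (b₀ c₀ p₀ : ℂ), c₀ ≠ 0 → ‖p₀‖ < 1 →
        (∃! u : ℝ → L2, IsSolution α (rationalData b₀ c₀ p₀) u) ∧
        ∀ u : ℝ → L2, IsSolution α (rationalData b₀ c₀ p₀) u →
          (α < 0 → ∀ s : ℝ, 0 ≤ s →
            ∃ C : ℝ, ∀ t : ℝ, MemHs s (u t) ∧ hsNorm s (u t) ≤ C) ∧
          (0 < α → ∀ s : ℝ, 1 / 2 < s →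
            (∀ t : ℝ, MemHs s (u t)) ∧
            ((∃ C : ℝ, 0 < C ∧ GrowsLikeExp s C u) ↔
              energy α (rationalData b₀ c₀ p₀)
                = (1 / 4) * mass (rationalData b₀ c₀ p₀) ^ 2
                  + (α / 2) * mass (rationalData b₀ c₀ p₀)) ∧
            (energy α (rationalData b₀ c₀ p₀)
                = (1 / 4) * mass (rationalData b₀ c₀ p₀) ^ 2
                  + (α / 2) * mass (rationalData b₀ c₀ p₀) →
              0 < rate α s (mass (rationalData b₀ c₀ p₀)) (momentum (rationalData b₀ c₀ p₀)) ∧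
              GrowsLikeExp s
                (rate α s (mass (rationalData b₀ c₀ p₀)) (momentum (rationalData b₀ c₀ p₀)))
                u)) := by
  refine ⟨growthRate, fun α b₀ c₀ p₀ hc₀ hp₀ ↦ ?_⟩
  have hδ := delta_pos_of_norm_lt hp₀
  have hδc : ((1 - ‖p₀‖ ^ 2 : ℝ) : ℂ) ≠ 0 := by exact_mod_cast hδ.ne'
  -- The reduced variable is `m = c / (1 - |p|²)`, so the orbit starts at `m₀ = c₀ / (1 - |p₀|²)`.
  obtain ⟨b, m, p, h, hb, hm, hp⟩ := exists_isReduced α (b₀ := b₀) (p₀ := p₀)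
    (div_ne_zero hc₀ hδc) hp₀
  have h0 : rationalData b₀ c₀ p₀
      = rationalData (b 0) (m 0 * (1 - p 0 * starRingEnd ℂ (p 0))) (p 0) := by
    rw [hb, hm, hp, ← ofReal_delta, div_mul_cancel₀ _ hδc]
  have hmn : ‖m 0‖ = ‖c₀‖ / (1 - ‖p₀‖ ^ 2) := by
    rw [hm, norm_div, Complex.norm_real, Real.norm_of_nonneg hδ.le]
  have hQ : mass (rationalData b₀ c₀ p₀) = ‖b 0‖ ^ 2 + ‖m 0‖ ^ 2 * (1 - ‖p 0‖ ^ 2) := by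
    rw [mass_rationalData _ _ hp₀, hmn, hb, hp]
    field_simp
  have hM : momentum (rationalData b₀ c₀ p₀) = ‖m 0‖ ^ 2 := by
    rw [momentum_rationalData _ _ hp₀, hmn, div_pow]
  have hK : energy α (rationalData b₀ c₀ p₀) = (1 / 4) * mass (rationalData b₀ c₀ p₀) ^ 2
      + (α / 2) * mass (rationalData b₀ c₀ p₀)
      ↔ ‖b 0 + m 0 * starRingEnd ℂ (p 0)‖ ^ 2 = α := by
    rw [← sub_eq_zero, energy_rationalData α b₀ c₀ hp₀, hb, hm, hp, mul_eq_zero, sub_eq_zero]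
    refine or_iff_right ?_
    have := norm_pos_iff.2 hc₀
    positivity
  refine ⟨⟨h.sol, h.isSolution h0, fun u hu ↦ h.eq_sol h0 hu⟩, fun u hu ↦ ?_⟩
  obtain rfl := h.eq_sol h0 hu
  refine ⟨fun hα s hs ↦ ?_, fun hα s hs ↦ ⟨h.memHs_sol (by linarith), ⟨?_, fun hE ↦ ?_⟩, fun hE ↦ ?_⟩⟩
  -- For `α < 0` the critical case is excluded because a square cannot equal `α`.
  · obtain ⟨C, hC⟩ := h.exists_hsNorm_sol_le
      (fun e ↦ absurd (sq_nonneg ‖b 0 + m 0 * starRingEnd ℂ (p 0)‖) (by rw [e]; exact not_le.2 hα)) hs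
    exact ⟨C, fun t ↦ ⟨h.memHs_sol hs t, hC t⟩⟩
  · rintro ⟨C, hC, hg⟩
    rw [hK]
    by_contra hne
    obtain ⟨B, hB⟩ := h.exists_hsNorm_sol_le hne (s := s) (by linarith)
    exact not_growsLikeExp_of_bounded hC hB hg
  · exact ⟨_, h.growsLikeExp hα hQ hM (hK.1 hE) hs⟩
  · exact h.growsLikeExp hα hQ hM (hK.1 hE) hs
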